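/- For $n,l\ge 1$ the Craig lattice $A_n^l\subset\mathbb R^{n+1}$ is the set of coefficient vectors of the elements of the ideal generated by $(x-1)^l$ in $\mathbb Z[x]/(x^{n+1}-1)$. For a lattice $\Lambda$ of rank $m$ let $\lambda_1(\Lambda)$ be its smallest nonzero Euclidean norm, $V(\Lambda)$ its volume (covolume in its real span), and $\Delta(\Lambda)=\operatorname{vol}(\mathcal B^m_{\lambda_1(\Lambda)/2})/V(\Lambda)$ its packing density. If $b=(\mathbf x_1,\dots,\mathbf x_n)$ is a basis of a lattice $\Lambda$ of rank $n$ and $p$ is a prime, the natural reduction $\phi_{p}:\Lambda\to\mathbb F_p^n$ with respect to $b$ is the homomorphism with $\phi_p(\mathbf x_i)=\mathbf e_i$ for all $i$; for a linear code $\mathcal C\subset\mathbb F_p^n$ put $\Lambda_p(\mathcal C)=\phi_p^{-1}(\mathcal C)$. Write $\lfloor\cdot\rceil$ for the nearest integer and $l_n=\lfloor n/(2\log(n+1))\rceil$. **Corollary.** For every $\nu>0$ there are primes $p_n$ with $p_n=O\big((n\sqrt{\log n})^{1+\nu}\big)$ as $n\to\infty$ such that the following holds. Let $(k_n)$ be any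 sequence of natural numbers whose rates $\delta_n=k_n/n$ satisfy $$\delta_n\sim\frac{\log\log n}{2\log n+\log\log n}\qquad(n\to\infty),$$ and let $\varepsilon>0$. Then for all sufficiently large $n$ with $n+1$ prime, the lattice $\Lambda=A_n^{l_n}$ has rank $n$ and, for every natural reduction $\phi_{p_n}$ of $\Lambda$ (that is, with respect to any basis of $\Lambda$), there is a linear code $\mathcal C\subset\mathbb F_{p_n}^n$ of dimension $k_n=\delta_n n$ such that $$\Delta\big(\Lambda_{p_n}(\mathcal C)\big)>\frac{1-\varepsilon}{2^{\,n-1}}.$$ -/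

import Mathlib

open Filter Asymptotics

noncomputable section

/-- The first minimum of a lattice: the infimum of the norms of its nonzero vectors. -/
def firstMinimum {E : Type*} [NormedAddCommGroup E] (L : Submodule ℤ E) : ℝ :=
  sInf {r : ℝ | ∃ x ∈ L, x ≠ 0 ∧ ‖x‖ = r}

/-- The lattice `L`, regarded as a lattice in the real subspace that it spans. -/
def latticeInSpan {E : Type*} [NormedAddCommGroup E] [InnerProductSpace ℝ E]
    (L : Submodule ℤ E) : Submodule ℤ (Submodule.span ℝ (L : Set E)) :=
  ZLattice.comap ℝ L (Submodule.span ℝ (L : Set E)).subtype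

/-- The packing density `vol (B_{λ₁ / 2}) / V(L)` of a lattice `L`, whose rank may be smaller than
the dimension of the ambient space: both volumes are Lebesgue measures in the real span of `L`. -/
def packingDensity {E : Type*} [NormedAddCommGroup E] [InnerProductSpace ℝ E]
    [FiniteDimensional ℝ E] [MeasurableSpace E] [BorelSpace E] (L : Submodule ℤ E) : ℝ :=
  (MeasureTheory.volume
      (Metric.closedBall (0 : Submodule.span ℝ (L : Set E)) (firstMinimum L / 2))).toReal /
    ZLattice.covolume (latticeInSpan L) MeasureTheory.volume

/-- The lattice `A_n^l`: the coefficient vectors of the elements of the ideal generated by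
`(x - 1)^l` in `ℤ[x] / (x^(n+1) - 1)`, the latter being the group ring over `ℤ` of the cyclic
group `ZMod (n + 1)`, with `x` the generator `1`. -/
def craigLattice (n l : ℕ) : Submodule ℤ (EuclideanSpace ℝ (ZMod (n + 1))) where
  carrier := {v | ∃ f ∈ Ideal.span
    {((AddMonoidAlgebra.single 1 1 - 1) ^ l : AddMonoidAlgebra ℤ (ZMod (n + 1)))},
      ∀ i, v i = (f.coeff i : ℝ)}
  zero_mem' := ⟨0, Ideal.zero_mem _, fun i => by simp⟩
  add_mem' := by
    rintro v w ⟨f, hf, hv⟩ ⟨g, hg, hw⟩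
    exact ⟨f + g, Ideal.add_mem _ hf hg, fun i => by simp [hv, hw]⟩
  smul_mem' := by
    rintro c v ⟨f, hf, hv⟩
    exact ⟨c • f, Submodule.smul_of_tower_mem _ c hf, fun i => by
      simp only [PiLp.smul_apply, hv, AddMonoidAlgebra.coeff_smul]; simp⟩

/-- The exponent `l`, the integer nearest to `n / (2 log (n + 1))`. -/
def craigExponent (n : ℕ) : ℕ :=
  (round ((n : ℝ) / (2 * Real.log ((n : ℝ) + 1)))).toNat

/-- The natural reduction modulo `p` with respect to a `ℤ`-basis `b` of `L`: the homomorphism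
`L → 𝔽_p^n` which maps the `i`-th basis vector to the `i`-th canonical vector. -/
def naturalReduction {E : Type*} [NormedAddCommGroup E] {L : Submodule ℤ E} {n : ℕ}
    (b : Module.Basis (Fin n) ℤ L) (p : ℕ) : L →ₗ[ℤ] (Fin n → ZMod p) :=
  b.constr ℤ fun i => Pi.single i 1

/-- The lattice `φ⁻¹(C)` associated to a linear code `C` via a reduction `φ : L → 𝔽_p^n`. -/
def codeLattice {E : Type*} [NormedAddCommGroup E] {L : Submodule ℤ E} {n p : ℕ}
    (φ : L →ₗ[ℤ] (Fin n → ZMod p)) (C : Submodule (ZMod p) (Fin n → ZMod p)) :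
    Submodule ℤ E :=
  ((C.restrictScalars ℤ).comap φ).map L.subtype

end

/-!
The proof averages over random linear codes. Let `Λ = A_n^l`, of rank `n` and volume `V`, and let
`r` be the radius with `vol (B_r) = 2 (1 - η) p ^ (n - k) V`. A lattice point that is not divisible
by `p` has a nonzero reduction, and a nonzero vector of `𝔽_p^n` lies in a random code of dimension
`k` with probability about `p ^ (k - n)`. So, if the ball of radius `r` contains about
`vol (B_r) / V` lattice points and none of them is divisible by `p`, the expected number of these
points in `Λ_p(C)` is less than `2`. They come in pairs `±x`, hence some `C` avoids all of them and
`λ₁(Λ_p(C)) ≥ r`, which is the asserted density. This is `exists_code_packingDensity_ge`; the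
codes used in the averaging are the multiples of one subspace of the field `𝔽_{p^n}`.

Two facts about Craig lattices are needed. No point of the ball is divisible by `p` when
`r ≤ p λ₁(Λ)`; here `λ₁(Λ)² ≥ l` because the lattice is contained in the one obtained by
Construction A from a Reed–Solomon code, and `V` is at most `3 ^ n` because the powers of `(x - 1)`
have successive index at most `n + 1`. For the rates `k / n` of the theorem, `p ^ (k / n)` exceeds
`√(log n)` by a power of `log n`, which absorbs all constants.

The count of points (`card_mul_covolume_le`) is the delicate point: the primes `p` are so small that
`r` is only about `n ^ (3 / 2 + ν)`, whereas covering arguments, with a covering radius of order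
`n`, would need `r` to be larger than `n ^ 2`. Minkowski's theorem gives a vector of norm at most
`4 √n`, and its cyclic shifts are `n` independent vectors of the same norm, since `n + 1` is prime
and the cyclotomic polynomial is irreducible. The translates of their Gram–Schmidt box tile the
space, and for a random point `u` of the box and a lattice point `x` the inner product `⟪x, u⟫` has
standard deviation at most `2 √n ‖x‖`. So most of the translate by `x` lies in a ball of radius
`r (1 + o(1 / n))` as soon as `n ^ (3 / 2)` is small compared with `r`.
-/

/-! ### Boxes with orthogonal sides -/

section Box
open MeasureTheory Metric
open scoped RealInnerProductSpace

variable {W : Type*} [NormedAddCommGroup W] [InnerProductSpace ℝ W] {ι : Type*} [Fintype ι]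

/-- The open box centred at the origin with axes along the orthonormal basis `e` and half side
lengths `c`. -/
def openBox (e : OrthonormalBasis ι ℝ W) (c : ι → ℝ) : Set W :=
  {u | ∀ i, |⟪e i, u⟫| < c i}

lemma mem_openBox {e : OrthonormalBasis ι ℝ W} {c : ι → ℝ} {u : W} :
    u ∈ openBox e c ↔ ∀ i, |⟪e i, u⟫| < c i := Iff.rfl

lemma isOpen_openBox (e : OrthonormalBasis ι ℝ W) (c : ι → ℝ) : IsOpen (openBox e c) := by
  simp only [openBox, Set.ofPred_forall]
  exact isOpen_iInter_of_finite fun i => isOpen_lt (by fun_prop) continuous_const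

lemma norm_sq_le_of_mem_openBox {e : OrthonormalBasis ι ℝ W} {c : ι → ℝ} {C : ℝ}
    (hc : ∀ i, c i ≤ C) {u : W} (hu : u ∈ openBox e c) : ‖u‖ ^ 2 ≤ Fintype.card ι * C ^ 2 := by
  rw [← e.sum_sq_norm_inner_right u]
  refine (Finset.sum_le_card_nsmul _ _ (C ^ 2) fun i _ => ?_).trans_eq (by simp)
  exact pow_le_pow_left₀ (norm_nonneg _) ((hu i).le.trans (hc i)) 2

lemma isBounded_openBox (e : OrthonormalBasis ι ℝ W) (c : ι → ℝ) :
    Bornology.IsBounded (openBox e c) := by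
  refine (isBounded_iff_forall_norm_le).2
    ⟨√(Fintype.card ι * (∑ i, |c i|) ^ 2), fun u hu => Real.le_sqrt_of_sq_le ?_⟩
  refine norm_sq_le_of_mem_openBox (fun i => ?_) hu
  exact (le_abs_self _).trans
    (Finset.single_le_sum (f := fun i => |c i|) (fun _ _ => abs_nonneg _) (Finset.mem_univ i))

variable [FiniteDimensional ℝ W] [MeasurableSpace W] [BorelSpace W]

lemma volume_openBox (e : OrthonormalBasis ι ℝ W) {c : ι → ℝ} (hc : ∀ i, 0 ≤ c i) :
    volume.real (openBox e c) = ∏ i, 2 * c i := by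
  have h1 : openBox e c = e.repr ⁻¹' ((MeasurableEquiv.toLp 2 (ι → ℝ)).symm ⁻¹'
      (Set.univ.pi fun i => Set.Ioo (-c i) (c i))) := by
    ext u
    simp [openBox, abs_lt, e.repr_apply_apply]
  have hm : MeasurableSet (Set.univ.pi fun i => Set.Ioo (-c i) (c i)) :=
    MeasurableSet.univ_pi fun i => measurableSet_Ioo
  rw [measureReal_def, h1, e.measurePreserving_repr.measure_preimage
    (((MeasurableEquiv.toLp 2 (ι → ℝ)).symm.measurable hm).nullMeasurableSet),
    (EuclideanSpace.volume_preserving_symm_measurableEquiv_toLp ι).measure_preimage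
      hm.nullMeasurableSet, Real.volume_pi_Ioo, ENNReal.toReal_prod]
  refine Finset.prod_congr rfl fun i _ => ?_
  rw [ENNReal.toReal_ofReal (by linarith [hc i])]
  ring

lemma volume_openBox_lt_top (e : OrthonormalBasis ι ℝ W) (c : ι → ℝ) :
    volume (openBox e c) < ⊤ := (isBounded_openBox e c).measure_lt_top

lemma integrableOn_openBox (e : OrthonormalBasis ι ℝ W) (c : ι → ℝ) {f : W → ℝ}
    (hf : Continuous f) : IntegrableOn f (openBox e c) :=
  (hf.locallyIntegrable.integrableOn_isCompact
    (isBounded_openBox e c).isCompact_closure).mono_set subset_closure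

/-- Distinct coordinates are uncorrelated on the box: the reflection in one of the axes preserves
the box and changes the sign of the product. -/
lemma setIntegral_openBox_inner_mul_inner (e : OrthonormalBasis ι ℝ W) (c : ι → ℝ) {i j : ι}
    (hij : i ≠ j) : ∫ u in openBox e c, ⟪e i, u⟫ * ⟪e j, u⟫ = 0 := by
  classical
  set ρ : W ≃ₗᵢ[ℝ] W := (ℝ ∙ e i)ᗮ.reflection with hρ
  have hi (u : W) : ⟪e i, ρ u⟫ = -⟪e i, u⟫ := by
    have h1 : ρ (e i) = -e i := Submodule.reflection_orthogonalComplement_singleton_eq_neg _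
    have h := ρ.inner_map_map (e i) u
    rw [h1, inner_neg_left] at h
    linarith
  have hj (k : ι) (hk : k ≠ i) (u : W) : ⟪e k, ρ u⟫ = ⟪e k, u⟫ := by
    have h1 : ρ (e k) = e k := by
      refine Submodule.reflection_mem_subspace_eq_self ?_
      rw [Submodule.mem_orthogonal_singleton_iff_inner_right]
      exact e.inner_eq_zero hk.symm
    have h := ρ.inner_map_map (e k) u
    rwa [h1] at h
  have hpre : ρ ⁻¹' openBox e c = openBox e c := by
    ext u
    simp only [Set.mem_preimage, mem_openBox]
    refine forall_congr' fun k => ?_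
    by_cases hk : k = i
    · subst hk; rw [hi, abs_neg]
    · rw [hj k hk]
  have h := ρ.measurePreserving.setIntegral_preimage_emb
    ρ.toHomeomorph.measurableEmbedding (fun u => ⟪e i, u⟫ * ⟪e j, u⟫) (openBox e c)
  rw [hpre] at h
  simp only [hi, hj j hij.symm, neg_mul, integral_neg] at h
  linarith

lemma setIntegral_openBox_inner_sq_le (e : OrthonormalBasis ι ℝ W) {c : ι → ℝ} {C : ℝ}
    (hc : ∀ i, c i ≤ C) (x : W) :
    ∫ u in openBox e c, ⟪x, u⟫ ^ 2 ≤ C ^ 2 * ‖x‖ ^ 2 * volume.real (openBox e c) := by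
  classical
  have hexp (u : W) : ⟪x, u⟫ ^ 2 =
      ∑ i, ∑ j, ⟪x, e i⟫ * ⟪x, e j⟫ * (⟪e i, u⟫ * ⟪e j, u⟫) := by
    rw [← e.sum_inner_mul_inner x u, sq, Finset.sum_mul_sum]
    exact Finset.sum_congr rfl fun i _ => Finset.sum_congr rfl fun j _ => by ring
  have hint (i j : ι) : IntegrableOn
      (fun u => ⟪x, e i⟫ * ⟪x, e j⟫ * (⟪e i, u⟫ * ⟪e j, u⟫)) (openBox e c) :=
    integrableOn_openBox e c (by fun_prop)
  simp_rw [hexp]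
  rw [integral_finsetSum _ fun i _ => integrable_finsetSum _ fun j _ => hint i j]
  have hdiag (i : ι) : ∫ u in openBox e c, ∑ j, ⟪x, e i⟫ * ⟪x, e j⟫ * (⟪e i, u⟫ * ⟪e j, u⟫) =
      ⟪x, e i⟫ ^ 2 * ∫ u in openBox e c, ⟪e i, u⟫ ^ 2 := by
    rw [integral_finsetSum _ fun j _ => hint i j]
    rw [Finset.sum_eq_single i]
    · rw [integral_const_mul]; simp only [sq]
    · intro j _ hj
      rw [integral_const_mul, setIntegral_openBox_inner_mul_inner e c hj.symm, mul_zero]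
    · simp
  simp_rw [hdiag]
  have hsq (i : ι) : ∫ u in openBox e c, ⟪e i, u⟫ ^ 2 ≤ C ^ 2 * volume.real (openBox e c) := by
    have := setIntegral_mono_on (integrableOn_openBox e c (f := fun u => ⟪e i, u⟫ ^ 2)
      (by fun_prop)) (integrableOn_openBox e c (f := fun _ => C ^ 2) continuous_const)
      (isOpen_openBox e c).measurableSet fun u hu => by
        rw [← sq_abs]
        exact pow_le_pow_left₀ (abs_nonneg _) ((hu i).le.trans (hc i)) 2
    rwa [setIntegral_const, smul_eq_mul, mul_comm] at this
  calc _ ≤ ∑ i, ⟪x, e i⟫ ^ 2 * (C ^ 2 * volume.real (openBox e c)) :=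
        Finset.sum_le_sum fun i _ => mul_le_mul_of_nonneg_left (hsq i) (sq_nonneg _)
    _ = _ := by
        rw [← Finset.sum_mul, ← e.sum_sq_norm_inner_left x]
        simp only [Real.norm_eq_abs, sq_abs]
        ring

/-- Chebyshev's inequality for the linear functional `⟪x, ·⟫` on a box. -/
lemma volume_openBox_inner_le (e : OrthonormalBasis ι ℝ W) {c : ι → ℝ} {C : ℝ}
    (hc : ∀ i, c i ≤ C) (x : W) {t : ℝ} (ht : 0 < t) :
    (1 - C ^ 2 * ‖x‖ ^ 2 / t ^ 2) * volume.real (openBox e c) ≤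
      volume.real (openBox e c ∩ {u | |⟪x, u⟫| ≤ t}) := by
  have hcheb := mul_meas_ge_le_integral_of_nonneg (μ := volume.restrict (openBox e c))
    (f := fun u => ⟪x, u⟫ ^ 2) (Eventually.of_forall fun u => sq_nonneg _)
    (integrableOn_openBox e c (by fun_prop)) (t ^ 2)
  have hle := hcheb.trans (setIntegral_openBox_inner_sq_le e hc x)
  have hms : MeasurableSet {u : W | t ^ 2 ≤ ⟪x, u⟫ ^ 2} :=
    (isClosed_le continuous_const (by fun_prop)).measurableSet
  rw [measureReal_restrict_apply hms] at hle
  have hfin : volume (openBox e c) ≠ ⊤ := (volume_openBox_lt_top e c).ne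
  have hsub : openBox e c ⊆ (openBox e c ∩ {u | |⟪x, u⟫| ≤ t}) ∪
      ({u : W | t ^ 2 ≤ ⟪x, u⟫ ^ 2} ∩ openBox e c) := by
    intro u hu
    rcases le_total |⟪x, u⟫| t with h | h
    · exact Or.inl ⟨hu, h⟩
    · exact Or.inr ⟨by simpa using pow_le_pow_left₀ ht.le h 2, hu⟩
  have h1 := (measureReal_mono hsub (measure_union_ne_top
    (ne_top_of_le_ne_top hfin (measure_mono Set.inter_subset_left))
    (ne_top_of_le_ne_top hfin (measure_mono Set.inter_subset_right)))).trans
    (measureReal_union_le _ _)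
  have h2 : volume.real ({u : W | t ^ 2 ≤ ⟪x, u⟫ ^ 2} ∩ openBox e c) ≤
      C ^ 2 * ‖x‖ ^ 2 / t ^ 2 * volume.real (openBox e c) := by
    rw [div_mul_eq_mul_div, le_div_iff₀ (by positivity)]
    linarith
  linarith

/-- The unit ball contains a cube of side length `2 / √n`. -/
lemma pow_le_volume_unitBall {n : ℕ} (hn : Module.finrank ℝ W = n) (hn0 : 0 < n) :
    (2 / √n) ^ n ≤ volume.real (ball (0 : W) 1) := by
  let e : OrthonormalBasis (Fin n) ℝ W := (stdOrthonormalBasis ℝ W).reindex (finCongr hn)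
  have hsub : openBox e (fun _ => 1 / √n) ⊆ closedBall 0 1 := fun u hu => by
    have h := norm_sq_le_of_mem_openBox (C := 1 / √n) (fun _ => le_rfl) hu
    have hn' : (0 : ℝ) < n := by exact_mod_cast hn0
    rw [div_pow, Real.sq_sqrt hn'.le, Fintype.card_fin, one_pow, mul_one_div_cancel hn'.ne'] at h
    rw [mem_closedBall_zero_iff]
    exact (sq_le_one_iff₀ (norm_nonneg u)).1 h
  have h := measureReal_mono (μ := volume) hsub (measure_closedBall_lt_top (x := (0 : W))).ne
  rw [volume_openBox e fun _ => by positivity, Measure.addHaar_real_closedBall _ _ zero_le_one,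
    one_pow, one_mul] at h
  simpa [div_eq_mul_inv] using h

end Box

/-! ### Counting lattice points in balls -/

section Counting
open MeasureTheory Metric Module
open scoped RealInnerProductSpace

variable {W : Type*} [NormedAddCommGroup W] [InnerProductSpace ℝ W] [FiniteDimensional ℝ W]

section GramSchmidt
variable {n : ℕ} (hn : finrank ℝ W = n) (v : Fin n → W)

/-- The Gram–Schmidt orthonormal basis of a family of vectors. -/
noncomputable def gramSchmidtFrame : OrthonormalBasis (Fin n) ℝ W :=
  InnerProductSpace.gramSchmidtOrthonormalBasis (hn.trans (Fintype.card_fin n).symm) v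

/-- The open box whose sides are the Gram–Schmidt orthogonalizations of the vectors `v i`: its
translates by the integer combinations of the `v i` are disjoint and fill the space up to a null
set. -/
noncomputable def gramSchmidtBox : Set W :=
  openBox (gramSchmidtFrame hn v) fun i => |⟪gramSchmidtFrame hn v i, v i⟫| / 2

/-- Distinct translates of the box by integer combinations of the `v i` are disjoint: the leading
coordinate of a nonzero combination is at least as long as the corresponding side of the box. -/
lemma eq_of_sub_mem_gramSchmidtBox {z x y : W} (hx : z - x ∈ gramSchmidtBox hn v)
    (hy : z - y ∈ gramSchmidtBox hn v) (hxy : x - y ∈ Submodule.span ℤ (Set.range v)) : x = y := by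
  classical
  obtain ⟨a, ha⟩ := (Submodule.mem_span_range_iff_exists_fun ℤ).1 hxy
  by_cases h0 : a = 0
  · rw [h0] at ha
    simpa [sub_eq_zero, eq_comm] using ha
  exfalso
  obtain ⟨i, hi⟩ := Function.ne_iff.1 h0
  obtain ⟨m, hm, hmax⟩ := (Finset.univ.filter fun i => a i ≠ 0).exists_max_image id
    ⟨i, by simpa using hi⟩
  simp only [Finset.mem_filter, Finset.mem_univ, true_and, id] at hm hmax
  have hco : ⟪gramSchmidtFrame hn v m, x - y⟫ = a m * ⟪gramSchmidtFrame hn v m, v m⟫ := by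
    rw [← ha, inner_sum, Finset.sum_eq_single m]
    · rw [← Int.cast_smul_eq_zsmul ℝ, inner_smul_right]
    · intro j _ hj
      rw [← Int.cast_smul_eq_zsmul ℝ, inner_smul_right]
      by_cases haj : a j = 0
      · simp [haj]
      · rw [gramSchmidtFrame, InnerProductSpace.gramSchmidtOrthonormalBasis_inv_triangular _ _
          (lt_of_le_of_ne (hmax j haj) hj), mul_zero]
    · simp
  have h1 := hx m
  have h2 := hy m
  have h3 : ⟪gramSchmidtFrame hn v m, x - y⟫ =
      ⟪gramSchmidtFrame hn v m, z - y⟫ - ⟪gramSchmidtFrame hn v m, z - x⟫ := by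
    rw [← inner_sub_right]; congr 1; abel
  have h4 := abs_sub ⟪gramSchmidtFrame hn v m, z - y⟫ ⟪gramSchmidtFrame hn v m, z - x⟫
  rw [← h3, hco, abs_mul] at h4
  have h5 : (1 : ℝ) ≤ |(a m : ℝ)| := by exact_mod_cast Int.one_le_abs hm
  nlinarith [abs_nonneg ⟪gramSchmidtFrame hn v m, v m⟫]

lemma abs_inner_gramSchmidtFrame_le {l : ℝ} (hl : ∀ i, ‖v i‖ ≤ l) (i : Fin n) :
    |⟪gramSchmidtFrame hn v i, v i⟫| ≤ l := by
  refine (abs_real_inner_le_norm _ _).trans ?_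
  rw [(gramSchmidtFrame hn v).norm_eq_one, one_mul]
  exact hl i

variable [MeasurableSpace W] [BorelSpace W]

lemma volume_gramSchmidtBox :
    volume.real (gramSchmidtBox hn v) = ∏ i, |⟪gramSchmidtFrame hn v i, v i⟫| := by
  rw [gramSchmidtBox, volume_openBox _ fun i => by positivity]
  exact Finset.prod_congr rfl fun i _ => by ring

variable {hn v} in
lemma covolume_span_eq_volume_gramSchmidtBox (b : Basis (Fin n) ℝ W) :
    ZLattice.covolume (Submodule.span ℤ (Set.range b)) = volume.real (gramSchmidtBox hn b) := by
  rw [ZLattice.covolume_eq_measure_fundamentalDomain _ _ (ZSpan.isAddFundamentalDomain b volume),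
    ZSpan.measureReal_fundamentalDomain b volume (gramSchmidtFrame hn b).toBasis,
    measureReal_congr (ZSpan.fundamentalDomain_ae_parallelepiped _ volume),
    OrthonormalBasis.coe_toBasis, measureReal_def, OrthonormalBasis.volume_parallelepiped,
    volume_gramSchmidtBox, gramSchmidtFrame, InnerProductSpace.gramSchmidtOrthonormalBasis_det,
    Finset.abs_prod]
  simp

end GramSchmidt

variable [MeasurableSpace W] [BorelSpace W]
  (L : Submodule ℤ W) [DiscreteTopology L] [IsZLattice ℝ L] {n : ℕ} {v : Fin n → W}

variable {L} in
/-- The volume of the Gram–Schmidt box of a linearly independent family in a lattice is a multiple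
of the covolume, by the index of the sublattice that the family spans. -/
lemma exists_index_mul_covolume (hn : finrank ℝ W = n) (hv : LinearIndependent ℝ v)
    (hvL : ∀ i, v i ∈ L) :
    (Submodule.span ℤ (Set.range v)).toAddSubgroup.relIndex L.toAddSubgroup ≠ 0 ∧
      volume.real (gramSchmidtBox hn v) =
        (Submodule.span ℤ (Set.range v)).toAddSubgroup.relIndex L.toAddSubgroup *
          ZLattice.covolume L := by
  set b : Basis (Fin n) ℝ W := basisOfLinearIndependentOfCardEqFinrank' v hv (by simp [hn]) with hb
  have hbv : v = b := by simp [hb]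
  rw [hbv] at hvL ⊢
  have hle : Submodule.span ℤ (Set.range b) ≤ L :=
    Submodule.span_le.2 (Set.range_subset_iff.2 hvL)
  have h := ZLattice.covolume_div_covolume_eq_relIndex' _ _ hle
  have hpos := ZLattice.covolume_pos L
  have hpos' := ZLattice.covolume_pos (Submodule.span ℤ (Set.range b))
  refine ⟨fun h0 => ?_, ?_⟩
  · rw [h0, Nat.cast_zero] at h
    exact (div_pos hpos' hpos).ne' h
  · rw [← h, div_mul_cancel₀ _ hpos.ne', covolume_span_eq_volume_gramSchmidtBox]

variable {L} in
/-- Hadamard's inequality for lattices. -/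
lemma covolume_le_pow (hn : finrank ℝ W = n) (hv : LinearIndependent ℝ v) (hvL : ∀ i, v i ∈ L)
    {l : ℝ} (hl : ∀ i, ‖v i‖ ≤ l) : ZLattice.covolume L ≤ l ^ n := by
  obtain ⟨h0, h⟩ := exists_index_mul_covolume hn hv hvL
  have h1 : (1 : ℝ) ≤
      (Submodule.span ℤ (Set.range v)).toAddSubgroup.relIndex L.toAddSubgroup := by
    exact_mod_cast Nat.one_le_iff_ne_zero.2 h0
  calc ZLattice.covolume L ≤ volume.real (gramSchmidtBox hn v) := by
        rw [h]; exact le_mul_of_one_le_left (ZLattice.covolume_pos L).le h1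
    _ ≤ ∏ _i : Fin n, l := by
        rw [volume_gramSchmidtBox]
        exact Finset.prod_le_prod (fun _ _ => abs_nonneg _) fun i _ =>
          abs_inner_gramSchmidtFrame_le hn v hl i
    _ = l ^ n := by simp

/-- If every point lies in at most `m` of finitely many sets inside `B`, their volumes add up to
at most `m` times that of `B`. -/
lemma sum_measureReal_le_mul {α X : Type*} [MeasurableSpace X] {μ : Measure X} (S : Finset α)
    {A : α → Set X} {B : Set X} (hB : μ B ≠ ⊤) (hA : ∀ a ∈ S, MeasurableSet (A a))
    (hBm : MeasurableSet B) (hAB : ∀ a ∈ S, A a ⊆ B) {m : ℕ}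
    (hm : ∀ z, Nat.card {a // a ∈ S ∧ z ∈ A a} ≤ m) :
    ∑ a ∈ S, μ.real (A a) ≤ m * μ.real B := by
  classical
  have h1 : ∑ a ∈ S, μ (A a) ≤ m * μ B := by
    calc ∑ a ∈ S, μ (A a) = ∑ a ∈ S, ∫⁻ z, (A a).indicator 1 z ∂μ :=
          Finset.sum_congr rfl fun a ha => (lintegral_indicator_one (hA a ha)).symm
      _ = ∫⁻ z, ∑ a ∈ S, (A a).indicator 1 z ∂μ :=
          (lintegral_finsetSum' _ fun a ha =>
            (measurable_one.indicator (hA a ha)).aemeasurable).symm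
      _ ≤ ∫⁻ z, B.indicator (fun _ => (m : ENNReal)) z ∂μ := by
          refine lintegral_mono fun z => ?_
          have hcard : ∑ a ∈ S, (A a).indicator (1 : X → ENNReal) z =
              ((S.filter fun a => z ∈ A a).card : ENNReal) := by
            simp [Set.indicator_apply]
          rw [hcard]
          by_cases hz : z ∈ B
          · rw [Set.indicator_of_mem hz]
            have := hm z
            rw [Nat.subtype_card (S.filter fun a => z ∈ A a) (by simp)] at this
            exact Nat.cast_le.2 this
          · rw [Set.indicator_of_notMem hz, Finset.filter_eq_empty_iff.2 fun a ha h =>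
              hz (hAB a ha h)]
            simp
      _ = m * μ B := by rw [lintegral_indicator_const hBm]
  have h2 := ENNReal.toReal_mono (ENNReal.mul_ne_top (ENNReal.natCast_ne_top m) hB) h1
  rw [ENNReal.toReal_sum fun a ha => ne_top_of_le_ne_top hB (measure_mono (hAB a ha)),
    ENNReal.toReal_mul, ENNReal.toReal_natCast] at h2
  exact h2

variable {L} in
/-- A lattice with `n` independent vectors of length at most `l` has at most about
`vol (B_r) / V(L)` points in the ball of radius `r`, once `n * l / r` is small. A point `x` of the
ball is replaced by the translate by `x` of the Gram–Schmidt box; by Chebyshev's inequality most of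
the translate lies in a slightly larger ball, since the typical value of `⟪x, u⟫` for `u` in the box
is only `‖x‖ * l`. -/
lemma card_mul_covolume_le (hn : finrank ℝ W = n) (hn0 : 0 < n) (hv : LinearIndependent ℝ v)
    (hvL : ∀ i, v i ∈ L) {l r s : ℝ} (hl : ∀ i, ‖v i‖ ≤ l) (hr : 0 < r) (hs : 0 < s) (hs1 : s ≤ 1)
    (hsr : n * l ≤ s ^ 2 * r) {S : Finset W} (hSL : ∀ x ∈ S, x ∈ L) (hSr : ∀ x ∈ S, ‖x‖ ≤ r) :
    (S.card * (1 - s ^ 2)) * ZLattice.covolume L ≤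
      Real.exp (2 * s) * r ^ n * volume.real (ball (0 : W) 1) := by
  obtain ⟨hm0, hvol⟩ := exists_index_mul_covolume hn hv hvL
  set m := (Submodule.span ℤ (Set.range v)).toAddSubgroup.relIndex L.toAddSubgroup with hm
  have hl0 : 0 < l := (norm_pos_iff.2 (hv.ne_zero ⟨0, hn0⟩)).trans_le (hl ⟨0, hn0⟩)
  have hnR : (1 : ℝ) ≤ n := by exact_mod_cast hn0
  set P := gramSchmidtBox hn v with hP
  have hc (i : Fin n) : |⟪gramSchmidtFrame hn v i, v i⟫| / 2 ≤ l / 2 :=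
    div_le_div_of_nonneg_right (abs_inner_gramSchmidtFrame_le hn v hl i) zero_le_two
  set t := r * l / s with ht
  have ht0 : 0 < t := by positivity
  set r' := r * Real.exp (2 * s / n) with hr'
  have hr'0 : 0 < r' := by positivity
  let A : W → Set W := fun x => (fun z => z - x) ⁻¹' (P ∩ {u | |⟪x, u⟫| ≤ t})
  have hPm : ∀ x : W, MeasurableSet (P ∩ {u | |⟪x, u⟫| ≤ t}) := fun x =>
    (isOpen_openBox _ _).measurableSet.inter
      (isClosed_le (by fun_prop) continuous_const).measurableSet
  have hAm : ∀ x ∈ S, MeasurableSet (A x) := fun x _ => (hPm x).preimage (measurable_sub_const x)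
  have hAB : ∀ x ∈ S, A x ⊆ closedBall 0 r' := by
    intro x hx z hz
    obtain ⟨hz1, hz2⟩ := hz
    have h1 := norm_sq_le_of_mem_openBox hc hz1
    rw [Fintype.card_fin] at h1
    have h2 := norm_add_sq_real x (z - x)
    rw [add_sub_cancel] at h2
    have h3 : ⟪x, z - x⟫ ≤ t := (le_abs_self _).trans hz2
    have h4 : ‖x‖ ^ 2 ≤ r ^ 2 := pow_le_pow_left₀ (norm_nonneg _) (hSr x hx) 2
    -- both error terms are at most a small multiple of `s * r ^ 2 / n`
    have h5 : n * t ≤ s * r ^ 2 := by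
      rw [ht, mul_div_assoc', div_le_iff₀ hs]
      nlinarith
    have h6 : n * (n * (l / 2) ^ 2) ≤ s * r ^ 2 / 4 := by
      have h7 : (n * l) ^ 2 ≤ (s ^ 2 * r) ^ 2 := pow_le_pow_left₀ (by positivity) hsr 2
      have h8 : (s ^ 2 * r) ^ 2 ≤ s * r ^ 2 := by
        have : s ^ 4 ≤ s := by
          calc s ^ 4 ≤ s ^ 1 := pow_le_pow_of_le_one hs.le hs1 (by norm_num)
            _ = s := pow_one s
        nlinarith [sq_nonneg r]
      nlinarith
    have h9 : ‖z‖ ^ 2 ≤ r' ^ 2 := by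
      have h10 : r' ^ 2 = r ^ 2 * Real.exp (4 * s / n) := by
        rw [hr', mul_pow, ← Real.exp_nat_mul]; congr 2; push_cast; ring
      have h11 : r ^ 2 * (4 * s / n + 1) ≤ r' ^ 2 := by
        rw [h10]; exact mul_le_mul_of_nonneg_left (Real.add_one_le_exp _) (sq_nonneg r)
      have h12 : 2 * t + n * (l / 2) ^ 2 ≤ r ^ 2 * (4 * s / n) := by
        rw [← mul_div_assoc (r ^ 2) (4 * s), le_div_iff₀ (by linarith)]
        nlinarith [mul_nonneg hs.le (sq_nonneg r)]
      nlinarith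
    rw [mem_closedBall_zero_iff]
    exact abs_le_of_sq_le_sq' h9 hr'0.le |>.2
  have hmul : ∀ z, Nat.card {x // x ∈ S ∧ z ∈ A x} ≤ m := by
    intro z
    rw [hm, AddSubgroup.relIndex, AddSubgroup.index]
    have : Finite (L.toAddSubgroup ⧸
        (Submodule.span ℤ (Set.range v)).toAddSubgroup.addSubgroupOf L.toAddSubgroup) :=
      (Nat.card_ne_zero.1 hm0).2
    refine Nat.card_le_card_of_injective (fun x => QuotientAddGroup.mk
      (⟨x.1, hSL x.1 x.2.1⟩ : L.toAddSubgroup)) fun x y hxy => ?_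
    rw [QuotientAddGroup.eq] at hxy
    have h1 : -x.1 + y.1 ∈ Submodule.span ℤ (Set.range v) := hxy
    refine Subtype.ext (eq_of_sub_mem_gramSchmidtBox hn v y.2.2.1 x.2.2.1 ?_).symm
    rwa [sub_eq_neg_add]
  have hsum := sum_measureReal_le_mul (μ := volume) S measure_closedBall_lt_top.ne hAm
    measurableSet_closedBall hAB hmul
  have hlow : ∀ x ∈ S, (1 - s ^ 2) * volume.real P ≤ volume.real (A x) := by
    intro x hx
    have h1 : volume.real (A x) = volume.real (P ∩ {u | |⟪x, u⟫| ≤ t}) := by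
      rw [measureReal_def, measureReal_def, (measurePreserving_sub_right volume x).measure_preimage
        (hPm x).nullMeasurableSet]
    rw [h1]
    refine le_trans ?_ (volume_openBox_inner_le _ hc x ht0)
    refine mul_le_mul_of_nonneg_right ?_ measureReal_nonneg
    have h2 : (l / 2) ^ 2 * ‖x‖ ^ 2 / t ^ 2 ≤ s ^ 2 := by
      rw [div_le_iff₀ (by positivity), ht, ← mul_pow, ← mul_pow, mul_div_cancel₀ _ hs.ne']
      refine pow_le_pow_left₀ (by positivity) ?_ 2
      nlinarith [hSr x hx, norm_nonneg x]
    linarith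
  have hfin := (Finset.sum_le_sum hlow).trans hsum
  rw [Finset.sum_const, nsmul_eq_mul, hvol, Measure.addHaar_real_closedBall _ _ hr'0.le, hn, hr',
    mul_pow, ← Real.exp_nat_mul, mul_div_cancel₀ _ (by linarith : (n : ℝ) ≠ 0)] at hfin
  have hmpos : (0 : ℝ) < m := by exact_mod_cast Nat.pos_of_ne_zero hm0
  refine le_of_mul_le_mul_left ?_ hmpos
  calc _ = S.card * ((1 - s ^ 2) * (m * ZLattice.covolume L)) := by ring
    _ ≤ _ := hfin
    _ = _ := by ring

variable {L} in
/-- Minkowski's theorem for balls. -/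
lemma exists_ne_zero_norm_lt (hn : finrank ℝ W = n) {r : ℝ} (hr : 0 < r)
    (h : ZLattice.covolume L * 2 ^ n < r ^ n * volume.real (ball (0 : W) 1)) :
    ∃ x ∈ L, x ≠ 0 ∧ ‖x‖ < r := by
  have fund := ZLattice.isAddFundamentalDomain (Free.chooseBasis ℤ L) (volume : Measure W)
  have hc : Countable L.toAddSubgroup := (inferInstance : Countable L)
  have hcov := ZLattice.covolume_eq_measure_fundamentalDomain L volume fund
  have hb : volume.real (ball (0 : W) r) = r ^ n * volume.real (ball (0 : W) 1) := by
    rw [measureReal_def, Measure.addHaar_ball_of_pos _ _ hr, hn, ENNReal.toReal_mul,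
      ENNReal.toReal_ofReal (by positivity), measureReal_def]
  have hF : volume (ZSpan.fundamentalDomain ((Free.chooseBasis ℤ L).ofZLatticeBasis ℝ)) ≠ ⊤ :=
    (ZSpan.fundamentalDomain_isBounded _).measure_lt_top.ne
  obtain ⟨x, hx0, hx⟩ := exists_ne_zero_mem_lattice_of_measure_mul_two_pow_lt_measure
    (L := L.toAddSubgroup) (s := ball 0 r) fund (fun x hx => by simpa using hx)
    (convex_ball 0 r) (by
      rw [← ENNReal.toReal_lt_toReal (ENNReal.mul_ne_top hF (by finiteness))
        measure_ball_lt_top.ne, ENNReal.toReal_mul, ENNReal.toReal_pow, hn]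
      rw [← measureReal_def, ← measureReal_def, ← hcov, hb]
      simpa using h)
  exact ⟨x, x.2, fun h => hx0 (Subtype.ext h), by simpa using hx⟩

end Counting

/-! ### Random codes and code lattices -/

section Codes
open MeasureTheory Metric Module

/-- Averaging over the multiples `a C₀`, `a ∈ 𝔽_{p^n}ˣ`, of a `k`-dimensional subspace `C₀` of
`𝔽_{p^n} ≅ 𝔽_p^n`: every nonzero vector lies in at most `p ^ k - 1` of these `p ^ n - 1` codes. -/
lemma exists_code_card_le_one {α : Type*} [Fintype α] {p n k : ℕ} [Fact p.Prime] (hn : n ≠ 0)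
    (hk : k ≤ n) (f : α → Fin n → ZMod p) (hf : ∀ x, f x ≠ 0)
    (hcard : Fintype.card α * (p ^ k - 1) < 2 * (p ^ n - 1)) :
    ∃ C : Submodule (ZMod p) (Fin n → ZMod p), finrank (ZMod p) C = k ∧
      Nat.card {x // f x ∈ C} ≤ 1 := by
  classical
  let F := GaloisField p n
  have : Fintype F := Fintype.ofFinite F
  have hF : finrank (ZMod p) F = n := GaloisField.finrank p hn
  let g : (Fin n → ZMod p) ≃ₗ[ZMod p] F := LinearEquiv.ofFinrankEq _ _ (by simp [hF])
  obtain ⟨w, hw⟩ := exists_linearIndependent_of_le_finrank (R := ZMod p) (M := F)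
    (hk.trans_eq hF.symm)
  set C₀ : Submodule (ZMod p) F := Submodule.span (ZMod p) (Set.range w) with hC₀
  have hC₀k : finrank (ZMod p) C₀ = k := by
    rw [hC₀, finrank_span_eq_card hw, Fintype.card_fin]
  let e (a : Fˣ) : (Fin n → ZMod p) ≃ₗ[ZMod p] F :=
    g.trans (DistribMulAction.toLinearEquiv (ZMod p) F a)
  have he (a : Fˣ) (x : Fin n → ZMod p) : e a x = a * g x := rfl
  by_contra! hcon
  have hbig (a : Fˣ) : 2 ≤ Fintype.card {x // e a (f x) ∈ C₀} := by
    have := hcon (C₀.comap (e a : (Fin n → ZMod p) →ₗ[ZMod p] F)) (by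
      rw [Submodule.comap_equiv_eq_map_symm, LinearEquiv.finrank_map_eq, hC₀k])
    rw [← Nat.card_eq_fintype_card]
    exact this
  have hsmall (x : α) : Fintype.card {a : Fˣ // e a (f x) ∈ C₀} ≤ p ^ k - 1 := by
    have hgx : g (f x) ≠ 0 := by simpa using hf x
    have h1 : Fintype.card {c : C₀ // c ≠ 0} = p ^ k - 1 := by
      rw [Fintype.card_subtype_compl, Fintype.card_subtype_eq,
        Module.card_eq_pow_finrank (K := ZMod p), hC₀k, ZMod.card]
    rw [← h1]
    refine Fintype.card_le_of_injective (fun a => ⟨⟨e a.1 (f x), a.2⟩, ?_⟩) fun a a' h => ?_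
    · simpa [Subtype.ext_iff, he] using hf x
    · simp only [Subtype.mk.injEq, he] at h
      exact Subtype.ext (Units.ext (mul_right_cancel₀ hgx h))
  have hdouble : ∑ a : Fˣ, Fintype.card {x // e a (f x) ∈ C₀} =
      ∑ x, Fintype.card {a : Fˣ // e a (f x) ∈ C₀} := by
    simp only [Fintype.card_subtype, Finset.card_filter]
    exact Finset.sum_comm
  have h1 : 2 * (p ^ n - 1) ≤ ∑ a : Fˣ, Fintype.card {x // e a (f x) ∈ C₀} := by
    have h2 := Finset.card_nsmul_le_sum Finset.univ _ 2 fun a _ => hbig a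
    rwa [Finset.card_univ, Fintype.card_units, ← Nat.card_eq_fintype_card, GaloisField.card p n hn,
      smul_eq_mul, mul_comm] at h2
  have h2 := Finset.sum_le_card_nsmul Finset.univ _ (p ^ k - 1) fun x _ => hsmall x
  rw [Finset.card_univ, smul_eq_mul] at h2
  omega

variable {E : Type*} [NormedAddCommGroup E] {L : Submodule ℤ E} {n : ℕ}
  (b : Basis (Fin n) ℤ L) (p : ℕ)

lemma naturalReduction_apply (x : L) (i : Fin n) :
    naturalReduction b p x i = (b.repr x i : ZMod p) := by
  rw [naturalReduction, Basis.constr_apply_fintype, Finset.sum_apply, Finset.sum_eq_single i]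
  · simp
  · intro j _ hj
    simp [Pi.single_eq_of_ne hj.symm]
  · simp

lemma naturalReduction_surjective : Function.Surjective (naturalReduction b p) := by
  intro c
  choose a ha using fun i => ZMod.intCast_surjective (c i)
  refine ⟨∑ i, a i • b i, funext fun i => ?_⟩
  rw [naturalReduction_apply, Basis.repr_sum_self, ha]

lemma exists_eq_smul_of_naturalReduction_eq_zero {x : L} (hx : naturalReduction b p x = 0) :
    ∃ y : L, x = (p : ℤ) • y := by
  have h (i : Fin n) : (p : ℤ) ∣ b.repr x i := by
    rw [← ZMod.intCast_zmod_eq_zero_iff_dvd, ← naturalReduction_apply, hx, Pi.zero_apply]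
  choose a ha using h
  refine ⟨∑ i, a i • b i, b.repr.injective (Finsupp.ext fun i => ?_)⟩
  rw [map_smul, Finsupp.smul_apply, Basis.repr_sum_self, ha, smul_eq_mul]

variable {b p}

lemma mem_codeLattice {C : Submodule (ZMod p) (Fin n → ZMod p)} {x : E} :
    x ∈ codeLattice (naturalReduction b p) C ↔ ∃ h : x ∈ L, naturalReduction b p ⟨x, h⟩ ∈ C := by
  simp [codeLattice]

lemma codeLattice_le (C : Submodule (ZMod p) (Fin n → ZMod p)) :
    codeLattice (naturalReduction b p) C ≤ L := fun _ hx => (mem_codeLattice.1 hx).1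

lemma smul_mem_codeLattice (C : Submodule (ZMod p) (Fin n → ZMod p)) {x : E} (hx : x ∈ L) :
    (p : ℤ) • x ∈ codeLattice (naturalReduction b p) C := by
  refine mem_codeLattice.2 ⟨L.smul_mem _ hx, ?_⟩
  have : naturalReduction b p ⟨(p : ℤ) • x, L.smul_mem _ hx⟩ = 0 := by
    rw [show (⟨(p : ℤ) • x, L.smul_mem _ hx⟩ : L) = (p : ℤ) • ⟨x, hx⟩ from rfl, map_smul]
    ext i
    simp
  rw [this]
  exact C.zero_mem

lemma relIndex_codeLattice [Fact p.Prime] (C : Submodule (ZMod p) (Fin n → ZMod p)) :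
    (codeLattice (naturalReduction b p) C).toAddSubgroup.relIndex L.toAddSubgroup =
      p ^ (n - finrank (ZMod p) C) := by
  have h1 : (codeLattice (naturalReduction b p) C).toAddSubgroup.addSubgroupOf L.toAddSubgroup =
      C.toAddSubgroup.comap (naturalReduction b p).toAddMonoidHom := by
    ext x
    simp only [AddSubgroup.mem_addSubgroupOf, Submodule.mem_toAddSubgroup, AddSubgroup.mem_comap]
    exact mem_codeLattice.trans ⟨fun ⟨_, h⟩ => h, fun h => ⟨x.2, h⟩⟩
  rw [AddSubgroup.relIndex, h1, AddSubgroup.index_comap_of_surjective _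
    (naturalReduction_surjective b p)]
  have hp : 0 < p := (Fact.out : p.Prime).pos
  have h2 := C.toAddSubgroup.index_mul_card
  have h3 : Nat.card C.toAddSubgroup = p ^ finrank (ZMod p) C := by
    have := Module.natCard_eq_pow_finrank (K := ZMod p) (V := C)
    rwa [Nat.card_zmod] at this
  have h4 : finrank (ZMod p) C ≤ n := (Submodule.finrank_le C).trans_eq (by simp)
  rw [h3, Nat.card_fun, Nat.card_zmod, Nat.card_fin] at h2
  refine Nat.eq_of_mul_eq_mul_right (pow_pos hp (finrank (ZMod p) C)) ?_
  rw [h2, ← pow_add, Nat.sub_add_cancel h4]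

end Codes

section Span
open MeasureTheory Metric Module

lemma discreteTopology_of_le {E : Type*} [NormedAddCommGroup E] {L' L : Submodule ℤ E}
    [DiscreteTopology L] (h : L' ≤ L) :
    DiscreteTopology L' := DiscreteTopology.of_subset (s := (L : Set E)) ‹_› h

variable {E : Type*} [NormedAddCommGroup E] [InnerProductSpace ℝ E]

instance discreteTopology_latticeInSpan (L : Submodule ℤ E) [DiscreteTopology L] :
    DiscreteTopology (latticeInSpan L) :=
  ZLattice.comap_discreteTopology ℝ L continuous_subtype_val Subtype.val_injective

instance isZLattice_latticeInSpan (L : Submodule ℤ E) [DiscreteTopology L] :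
    IsZLattice ℝ (latticeInSpan L) where
  span_top := by
    refine Submodule.map_injective_of_injective
      (Submodule.span ℝ (L : Set E)).injective_subtype ?_
    rw [Submodule.map_span, Submodule.map_top, Submodule.range_subtype]
    congr 1
    ext x
    refine ⟨?_, fun hx => ⟨⟨x, Submodule.subset_span hx⟩, hx, rfl⟩⟩
    rintro ⟨y, hy, rfl⟩
    exact hy

variable [FiniteDimensional ℝ E] [MeasurableSpace E] [BorelSpace E]

/-- The covolume of a sublattice `L'` of `L` that spans the same real subspace. It is computed in
the span of `L`, to which the span of `L'` is equal only propositionally. -/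
lemma covolume_comap_subtype_eq (L' L : Submodule ℤ E) [DiscreteTopology L] (hle : L' ≤ L)
    (hspan : Submodule.span ℝ (L : Set E) = Submodule.span ℝ (L' : Set E)) :
    ZLattice.covolume (ZLattice.comap ℝ L' (Submodule.span ℝ (L : Set E)).subtype) =
      L'.toAddSubgroup.relIndex L.toAddSubgroup * ZLattice.covolume (latticeInSpan L) := by
  have hd := discreteTopology_of_le hle
  have hinst : ∃ _ : DiscreteTopology
      (ZLattice.comap ℝ L' (Submodule.span ℝ (L : Set E)).subtype),
      IsZLattice ℝ (ZLattice.comap ℝ L' (Submodule.span ℝ (L : Set E)).subtype) := by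
    rw [hspan]
    exact ⟨discreteTopology_latticeInSpan L', isZLattice_latticeInSpan L'⟩
  obtain ⟨_, _⟩ := hinst
  have h := ZLattice.covolume_div_covolume_eq_relIndex'
    (ZLattice.comap ℝ L' (Submodule.span ℝ (L : Set E)).subtype) (latticeInSpan L)
    (Submodule.comap_mono hle)
  have hidx : (ZLattice.comap ℝ L' (Submodule.span ℝ (L : Set E)).subtype).toAddSubgroup.relIndex
      (latticeInSpan L).toAddSubgroup = L'.toAddSubgroup.relIndex L.toAddSubgroup := by
    have h1 : (ZLattice.comap ℝ L' (Submodule.span ℝ (L : Set E)).subtype).toAddSubgroup =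
      L'.toAddSubgroup.comap (Submodule.span ℝ (L : Set E)).subtype.toAddMonoidHom := rfl
    rw [h1, AddSubgroup.relIndex_comap]
    congr 1
    ext x
    refine ⟨?_, fun hx => ⟨⟨x, Submodule.subset_span hx⟩, hx, rfl⟩⟩
    rintro ⟨y, hy, rfl⟩
    exact hy
  rw [hidx] at h
  exact (div_eq_iff (ZLattice.covolume_pos (latticeInSpan L)).ne').1 h

lemma packingDensity_eq (L' L : Submodule ℤ E) [DiscreteTopology L] (hle : L' ≤ L)
    (hspan : Submodule.span ℝ (L : Set E) = Submodule.span ℝ (L' : Set E)) :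
    packingDensity L' =
      volume.real (closedBall (0 : Submodule.span ℝ (L : Set E)) (firstMinimum L' / 2)) /
        (L'.toAddSubgroup.relIndex L.toAddSubgroup * ZLattice.covolume (latticeInSpan L)) := by
  rw [← covolume_comap_subtype_eq L' L hle hspan, hspan]
  rfl

/-- The volume of the sublattice is the index times the volume of the lattice. -/
lemma covolume_latticeInSpan_eq (L' L : Submodule ℤ E) [DiscreteTopology L] (hle : L' ≤ L)
    (hspan : Submodule.span ℝ (L : Set E) = Submodule.span ℝ (L' : Set E)) :
    ZLattice.covolume (latticeInSpan L') =
      L'.toAddSubgroup.relIndex L.toAddSubgroup * ZLattice.covolume (latticeInSpan L) := by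
  rw [← covolume_comap_subtype_eq L' L hle hspan, hspan]
  rfl

/-- The density of the best code lattice. The short independent vectors `v i` guarantee that the
ball of radius `r` contains fewer than `2 p ^ (n - k)` nonzero lattice points, and `r ≤ p * m`
that none of them is divisible by `p`. So some code lattice of dimension `k` contains at most one
of these points, hence none, because it is symmetric. -/
theorem exists_code_packingDensity_ge (L : Submodule ℤ E) [DiscreteTopology L] {n : ℕ}
    (hn0 : 0 < n) (hd : finrank ℝ (Submodule.span ℝ (L : Set E)) = n) (b : Basis (Fin n) ℤ L)
    {p : ℕ} (hp : p.Prime) {k : ℕ} (hk : k ≤ n) {v : Fin n → E} (hv : LinearIndependent ℝ v)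
    (hvL : ∀ i, v i ∈ L) {l m s r η : ℝ} (hl : ∀ i, ‖v i‖ ≤ l) (hm : ∀ x ∈ L, x ≠ 0 → m ≤ ‖x‖)
    (hr : 0 < r)
    (hrV : r ^ n * volume.real (ball (0 : Submodule.span ℝ (L : Set E)) 1) =
      2 * (1 - η) * p ^ (n - k) * ZLattice.covolume (latticeInSpan L))
    (hrm : r ≤ p * m) (hs : 0 < s) (hs1 : s < 1) (hsr : n * l ≤ s ^ 2 * r)
    (hη : Real.exp (2 * s) * (1 - η) < 1 - s ^ 2) :
    ∃ C : Submodule (ZMod p) (Fin n → ZMod p), finrank (ZMod p) C = k ∧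
      (1 - η) / 2 ^ (n - 1) ≤ packingDensity (codeLattice (naturalReduction b p) C) := by
  classical
  have : Fact p.Prime := ⟨hp⟩
  set V := ZLattice.covolume (latticeInSpan L) with hV
  have hV0 : 0 < V := ZLattice.covolume_pos (latticeInSpan L)
  have hp0 : (0 : ℝ) < p := by exact_mod_cast hp.pos
  have hfin : {x : Submodule.span ℝ (L : Set E) |
      x ∈ latticeInSpan L ∧ x ≠ 0 ∧ ‖x‖ < r}.Finite := by
    refine (ZSpan.setFinite_inter
      ((Free.chooseBasis ℤ (latticeInSpan L)).ofZLatticeBasis ℝ)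
      (isBounded_ball (x := 0) (r := r))).subset ?_
    rintro x ⟨h1, -, h3⟩
    refine ⟨by simpa using h3, ?_⟩
    rw [SetLike.mem_coe, Basis.ofZLatticeBasis_span]
    exact h1
  set S := hfin.toFinset with hS
  have hmemS {x : Submodule.span ℝ (L : Set E)} :
      x ∈ S ↔ (x : E) ∈ L ∧ x ≠ 0 ∧ ‖x‖ < r := by
    rw [hS, Set.Finite.mem_toFinset]; rfl
  have hcount := card_mul_covolume_le (L := latticeInSpan L) hd hn0
    (v := fun i => ⟨v i, Submodule.subset_span (hvL i)⟩)
    (LinearIndependent.of_comp (Submodule.span ℝ (L : Set E)).subtype hv) hvL hl hr hs hs1.le hsr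
    (S := S) (fun x hx => (hmemS.1 hx).1) (fun x hx => (hmemS.1 hx).2.2.le)
  have hs2 : 0 < 1 - s ^ 2 := by nlinarith
  have hN : S.card < 2 * p ^ (n - k) := by
    have h1 : (S.card * (1 - s ^ 2)) * V < (2 * p ^ (n - k) * (1 - s ^ 2)) * V := by
      refine hcount.trans_lt ?_
      rw [mul_assoc, hrV]
      have : 0 < 2 * (p : ℝ) ^ (n - k) * V := by positivity
      nlinarith
    have h2 := lt_of_mul_lt_mul_right (lt_of_mul_lt_mul_right h1 hV0.le) hs2.le
    exact_mod_cast h2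
  have hNk : Fintype.card S * (p ^ k - 1) < 2 * (p ^ n - 1) := by
    rw [Fintype.card_coe]
    have h1 : p ^ n = p ^ (n - k) * p ^ k := by rw [← pow_add, Nat.sub_add_cancel hk]
    have h2 : 2 ≤ p := hp.two_le
    have h3 : 1 ≤ p ^ (n - k) := Nat.one_le_pow _ _ hp.pos
    have h5 : 2 ≤ p ^ n := h2.trans (Nat.le_self_pow hn0.ne' p)
    rcases Nat.eq_zero_or_pos k with rfl | hk0
    · simp; omega
    have h4 : 2 ≤ p ^ k := h2.trans (Nat.le_self_pow hk0.ne' p)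
    obtain ⟨c, hc⟩ := Nat.exists_eq_add_of_le h4
    obtain ⟨d, hd'⟩ := Nat.exists_eq_add_of_le h3
    have h6 : S.card ≤ 2 * d + 1 := by omega
    rw [h1, hc, hd']
    have h7 : S.card * (2 + c - 1) ≤ (2 * d + 1) * (2 + c - 1) := Nat.mul_le_mul_right _ h6
    have h8 : 2 + c - 1 = c + 1 := by omega
    have h9 : (1 + d) * (2 + c) - 1 = d * c + 2 * d + c + 1 := by
      rw [Nat.sub_eq_iff_eq_add (by nlinarith)]; ring
    rw [h8] at h7 ⊢
    rw [h9]
    nlinarith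
  have hpm {y : E} (hy : y ∈ L) (hy0 : (p : ℤ) • y ≠ 0) : r ≤ ‖(p : ℤ) • y‖ := by
    have hy1 : y ≠ 0 := fun h => hy0 (by simp [h])
    rw [← Int.cast_smul_eq_zsmul ℝ, norm_smul]
    simp only [Int.cast_natCast, Real.norm_natCast]
    exact hrm.trans (mul_le_mul_of_nonneg_left (hm y hy hy1) hp0.le)
  obtain ⟨C, hCk, hC⟩ := exists_code_card_le_one (p := p) hn0.ne' hk
    (fun x : S => naturalReduction b p ⟨(x.1 : E), (hmemS.1 x.2).1⟩) (fun x hx => by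
      obtain ⟨y, hy⟩ := exists_eq_smul_of_naturalReduction_eq_zero b p hx
      have hy' : ((x.1 : Submodule.span ℝ (L : Set E)) : E) = (p : ℤ) • (y : E) :=
        congrArg Subtype.val hy
      have h1 := (hmemS.1 x.2).2
      have h2 := hpm y.2 (by
        rw [← hy']; exact fun h => h1.1 (Subtype.ext h))
      rw [← hy'] at h2
      exact absurd h1.2 (not_lt.2 h2)) hNk
  refine ⟨C, hCk, ?_⟩
  set L' := codeLattice (naturalReduction b p) C with hL'
  have hle : L' ≤ L := codeLattice_le C
  have hspan : Submodule.span ℝ (L : Set E) = Submodule.span ℝ (L' : Set E) := by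
    refine le_antisymm (Submodule.span_le.2 fun x hx => ?_) (Submodule.span_mono hle)
    have h1 : (p : ℝ)⁻¹ • ((p : ℤ) • x) ∈ Submodule.span ℝ (L' : Set E) :=
      Submodule.smul_mem _ _ (Submodule.subset_span (smul_mem_codeLattice C hx))
    rwa [← Int.cast_smul_eq_zsmul ℝ, Int.cast_natCast, inv_smul_smul₀ hp0.ne'] at h1
  have hmin : r ≤ firstMinimum L' := by
    refine le_csInf ?_ ?_
    · have h0 : (p : ℤ) • v ⟨0, hn0⟩ ≠ 0 := by
          rw [← Int.cast_smul_eq_zsmul ℝ, Int.cast_natCast]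
          exact smul_ne_zero hp0.ne' (hv.ne_zero _)
      exact ⟨_, _, smul_mem_codeLattice C (hvL ⟨0, hn0⟩), h0, rfl⟩
    · rintro _ ⟨x, hx, hx0, rfl⟩
      by_contra! hlt
      obtain ⟨hxL, hxC⟩ := mem_codeLattice.1 hx
      -- both `x` and `-x` would be among the points of the ball that reduce into the code
      have hxS : (⟨x, Submodule.subset_span hxL⟩ : Submodule.span ℝ (L : Set E)) ∈ S :=
        hmemS.2 ⟨hxL, fun h => hx0 (congrArg Subtype.val h), hlt⟩
      have hxS' : (⟨-x, Submodule.subset_span (L.neg_mem hxL)⟩ :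
          Submodule.span ℝ (L : Set E)) ∈ S :=
        hmemS.2 ⟨L.neg_mem hxL, fun h => hx0 (neg_eq_zero.1 (congrArg Subtype.val h)), by
          rw [← norm_neg] at hlt; exact hlt⟩
      have hxC' : naturalReduction b p ⟨-x, L.neg_mem hxL⟩ ∈ C := by
        rw [show (⟨-x, L.neg_mem hxL⟩ : L) = -⟨x, hxL⟩ from rfl, map_neg]
        exact C.neg_mem hxC
      have hsub := (Finite.card_le_one_iff_subsingleton).1 hC
      have heq := hsub.elim ⟨⟨_, hxS⟩, hxC⟩ ⟨⟨_, hxS'⟩, hxC'⟩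
      have heq' : x = -x := congrArg (fun z => ((z.1.1 : Submodule.span ℝ (L : Set E)) : E)) heq
      have h2 : (2 : ℝ) • x = 0 := by
        rw [two_smul]; exact eq_neg_iff_add_eq_zero.1 heq'
      exact hx0 ((smul_eq_zero_iff_right two_ne_zero).1 h2)
  rw [packingDensity_eq L' L hle hspan, relIndex_codeLattice, hCk, ← hV, Nat.cast_pow,
    le_div_iff₀ (mul_pos (pow_pos hp0 _) hV0),
    Measure.addHaar_real_closedBall _ _ (by linarith), hd]
  have h2 : (2 : ℝ) ^ n = 2 * 2 ^ (n - 1) := by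
    rw [← pow_succ', Nat.sub_add_cancel hn0]
  calc (1 - η) / 2 ^ (n - 1) * (p ^ (n - k) * V) =
        (2 * (1 - η) * p ^ (n - k) * V) / 2 ^ n := by rw [h2]; field_simp
    _ = (r / 2) ^ n * volume.real (ball (0 : Submodule.span ℝ (L : Set E)) 1) := by
        rw [← hrV, div_pow]; ring
    _ ≤ _ := by
        refine mul_le_mul_of_nonneg_right ?_ measureReal_nonneg
        exact pow_le_pow_left₀ (by positivity) (by linarith) n

end Span

/-! ### Powers of `x - 1` in the group ring of a cyclic group -/

section GroupRing
open Module
open scoped fwdDiff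

variable {n : ℕ}

/-- The element `x - 1` of the group ring `ℤ[x] / (x ^ (n + 1) - 1)`. -/
noncomputable abbrev xSubOne (n : ℕ) : AddMonoidAlgebra ℤ (ZMod (n + 1)) :=
  AddMonoidAlgebra.single 1 1 - 1

lemma coeff_single_one_mul' (f : AddMonoidAlgebra ℤ (ZMod (n + 1))) (a i : ZMod (n + 1)) :
    (AddMonoidAlgebra.single a 1 * f).coeff i = f.coeff (i - a) := by
  rw [AddMonoidAlgebra.coeff_single_mul_eq_mul_coeff (i - a), one_mul]
  intro m _
  rw [eq_sub_iff_add_eq, add_comm a m]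

lemma coeff_xSubOne_mul (f : AddMonoidAlgebra ℤ (ZMod (n + 1))) (i : ZMod (n + 1)) :
    (xSubOne n * f).coeff i = f.coeff (i - 1) - f.coeff i := by
  rw [sub_mul, one_mul, AddMonoidAlgebra.coeff_sub, Finsupp.sub_apply, coeff_single_one_mul']

lemma single_eq_pow (a : ZMod (n + 1)) :
    (AddMonoidAlgebra.single a 1 : AddMonoidAlgebra ℤ (ZMod (n + 1))) =
      AddMonoidAlgebra.single 1 1 ^ a.val := by
  rw [AddMonoidAlgebra.single_pow, one_pow, nsmul_one, ZMod.natCast_zmod_val]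

lemma xSubOne_dvd_pow_sub_one (k : ℕ) :
    xSubOne n ∣ AddMonoidAlgebra.single 1 1 ^ k - 1 := by
  simpa using sub_dvd_pow_sub_pow
    (AddMonoidAlgebra.single 1 1 : AddMonoidAlgebra ℤ (ZMod (n + 1))) 1 k

lemma exists_xSubOne_dvd_sub (f : AddMonoidAlgebra ℤ (ZMod (n + 1))) :
    ∃ c : ℤ, xSubOne n ∣ f - c := by
  induction f using AddMonoidAlgebra.induction_on with
  | of m =>
    refine ⟨1, ?_⟩
    have : (AddMonoidAlgebra.of ℤ (ZMod (n + 1))) (Multiplicative.ofAdd m) =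
        AddMonoidAlgebra.single m 1 := rfl
    rw [this, single_eq_pow, Int.cast_one]
    exact xSubOne_dvd_pow_sub_one _
  | add x y hx hy =>
    obtain ⟨c, hc⟩ := hx
    obtain ⟨d, hd⟩ := hy
    refine ⟨c + d, ?_⟩
    have := dvd_add hc hd
    rwa [sub_add_sub_comm, ← Int.cast_add] at this
  | smul r x hx =>
    obtain ⟨c, hc⟩ := hx
    refine ⟨r * c, ?_⟩
    have := hc.mul_left (r : AddMonoidAlgebra ℤ (ZMod (n + 1)))
    rwa [mul_sub, ← zsmul_eq_mul, ← Int.cast_mul] at this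

/-- Modulo `x - 1` the integer `n + 1` is the norm element `1 + x + ⋯ + x ^ n`, which `x - 1`
annihilates. -/
lemma xSubOne_pow_dvd_natCast_mul (j : ℕ) :
    xSubOne n ^ (j + 2) ∣
      ((n + 1 : ℕ) : AddMonoidAlgebra ℤ (ZMod (n + 1))) * xSubOne n ^ (j + 1) := by
  set x : AddMonoidAlgebra ℤ (ZMod (n + 1)) := AddMonoidAlgebra.single 1 1 with hx
  have h1 : xSubOne n * ∑ i ∈ Finset.range (n + 1), x ^ i = 0 := by
    rw [mul_geom_sum, AddMonoidAlgebra.single_pow, one_pow, nsmul_one, ZMod.natCast_self]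
    exact sub_self _
  have h2 : xSubOne n ∣ ∑ i ∈ Finset.range (n + 1), x ^ i - ((n + 1 : ℕ) :
      AddMonoidAlgebra ℤ (ZMod (n + 1))) := by
    have : ∑ i ∈ Finset.range (n + 1), x ^ i - ((n + 1 : ℕ) : AddMonoidAlgebra ℤ (ZMod (n + 1))) =
        ∑ i ∈ Finset.range (n + 1), (x ^ i - 1) := by simp
    rw [this]
    exact Finset.dvd_sum fun i _ => xSubOne_dvd_pow_sub_one i
  obtain ⟨h, hh⟩ := h2
  refine ⟨-h, ?_⟩
  rw [← sub_eq_zero]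
  calc _ = (xSubOne n * ∑ i ∈ Finset.range (n + 1), x ^ i) * xSubOne n ^ j -
        xSubOne n ^ (j + 1) * ((∑ i ∈ Finset.range (n + 1), x ^ i -
          ((n + 1 : ℕ) : AddMonoidAlgebra ℤ (ZMod (n + 1)))) - xSubOne n * h) := by ring
    _ = 0 := by rw [h1, hh]; ring

lemma xSubOne_ne_zero (hn : n ≠ 0) : xSubOne n ≠ 0 := by
  have : Fact (1 < n + 1) := ⟨by omega⟩
  intro h
  have h1 := congrArg (fun f => f.coeff 1) h
  simp [AddMonoidAlgebra.coeff_sub, AddMonoidAlgebra.one_def] at h1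

lemma xSubOne_pow_ne_zero (hn : n ≠ 0) (l : ℕ) : xSubOne n ^ l ≠ 0 := by
  induction l with
  | zero =>
    intro h
    have h1 := congrArg (fun f => f.coeff 0) h
    simp [AddMonoidAlgebra.one_def] at h1
  | succ l ih =>
    rcases l with _ | l
    · simpa using xSubOne_ne_zero hn
    intro h
    have h1 := xSubOne_pow_dvd_natCast_mul (n := n) l
    rw [h, zero_dvd_iff, ← nsmul_eq_mul] at h1
    refine ih (AddMonoidAlgebra.ext (Finsupp.ext fun i => ?_))
    have h2 := congrArg (fun f => f.coeff i) h1
    simp only [AddMonoidAlgebra.coeff_smul, Finsupp.smul_apply, AddMonoidAlgebra.coeff_zero,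
      Finsupp.zero_apply] at h2 ⊢
    exact (smul_eq_zero.1 h2).resolve_left (by omega)

/-- The ideal generated by `(x - 1) ^ l`. -/
noncomputable abbrev craigIdeal (n l : ℕ) : Ideal (AddMonoidAlgebra ℤ (ZMod (n + 1))) :=
  Ideal.span {xSubOne n ^ l}

lemma mem_craigIdeal {l : ℕ} {f : AddMonoidAlgebra ℤ (ZMod (n + 1))} :
    f ∈ craigIdeal n l ↔ xSubOne n ^ l ∣ f := Ideal.mem_span_singleton

lemma craigIdeal_le {l m : ℕ} (h : l ≤ m) : craigIdeal n m ≤ craigIdeal n l := fun _ hf =>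
  mem_craigIdeal.2 ((pow_dvd_pow _ h).trans (mem_craigIdeal.1 hf))

/-- The quotient of consecutive powers is cyclic, generated by `(x - 1) ^ (j + 1)`, and killed by
`n + 1`. -/
lemma relIndex_craigIdeal_succ_le (j : ℕ) :
    (craigIdeal n (j + 2)).toAddSubgroup.relIndex (craigIdeal n (j + 1)).toAddSubgroup ≤ n + 1 := by
  rw [AddSubgroup.relIndex, AddSubgroup.index]
  have hmem (c : ℤ) : (c : AddMonoidAlgebra ℤ (ZMod (n + 1))) * xSubOne n ^ (j + 1) ∈
      (craigIdeal n (j + 1)).toAddSubgroup := mem_craigIdeal.2 (dvd_mul_left _ _)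
  refine (Nat.card_le_card_of_surjective (fun c : Fin (n + 1) => QuotientAddGroup.mk
    (⟨_, hmem (c : ℕ)⟩ : (craigIdeal n (j + 1)).toAddSubgroup)) fun u => ?_).trans_eq
    (Nat.card_fin _)
  induction u using QuotientAddGroup.induction_on with | _ u => ?_
  obtain ⟨u, hu⟩ := u
  obtain ⟨g, hg⟩ := mem_craigIdeal.1 hu
  obtain ⟨c, h, hc⟩ := exists_xSubOne_dvd_sub g
  obtain ⟨d, hd⟩ := xSubOne_pow_dvd_natCast_mul (n := n) j
  have hq : (0 : ℤ) < (n + 1 : ℕ) := by positivity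
  have hnn := Int.emod_nonneg c hq.ne'
  have hlt := Int.emod_lt_of_pos c hq
  refine ⟨⟨(c % (n + 1 : ℕ)).toNat, by omega⟩, ?_⟩
  rw [QuotientAddGroup.eq]
  refine mem_craigIdeal.2 ⟨h + ((c / (n + 1 : ℕ) : ℤ) : AddMonoidAlgebra ℤ (ZMod (n + 1))) * d, ?_⟩
  have hdm : ((c % (n + 1 : ℕ) : ℤ) : AddMonoidAlgebra ℤ (ZMod (n + 1))) =
      c - ((n + 1 : ℕ) : AddMonoidAlgebra ℤ (ZMod (n + 1))) * ((c / (n + 1 : ℕ) : ℤ) :) := by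
    rw [Int.emod_def]; push_cast; ring
  simp only [AddSubgroup.subtype_apply, AddSubgroup.coe_add, NegMemClass.coe_neg,
    Int.toNat_of_nonneg hnn]
  rw [hdm, hg]
  linear_combination xSubOne n ^ (j + 1) * hc + ((c / (n + 1 : ℕ) : ℤ) :
    AddMonoidAlgebra ℤ (ZMod (n + 1))) * hd

lemma relIndex_craigIdeal_le (j : ℕ) :
    (craigIdeal n (j + 1)).toAddSubgroup.relIndex (craigIdeal n 1).toAddSubgroup ≤
      (n + 1) ^ j := by
  induction j with
  | zero => simp
  | succ j ih =>
    rw [← AddSubgroup.relIndex_mul_relIndex _ _ _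
      (show (craigIdeal n (j + 2)).toAddSubgroup ≤ (craigIdeal n (j + 1)).toAddSubgroup from
        craigIdeal_le (by omega))
      (show (craigIdeal n (j + 1)).toAddSubgroup ≤ (craigIdeal n 1).toAddSubgroup from
        craigIdeal_le (by omega)), pow_succ']
    exact Nat.mul_le_mul (relIndex_craigIdeal_succ_le j) ih

/-- Pairing the coefficients, reduced modulo `n + 1`, with a function on `ZMod (n + 1)`. -/
noncomputable def modPairing (P : ZMod (n + 1) → ZMod (n + 1))
    (f : AddMonoidAlgebra ℤ (ZMod (n + 1))) : ZMod (n + 1) :=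
  ∑ i, (f.coeff i : ZMod (n + 1)) * P i

/-- Multiplication by `x - 1` is adjoint to the forward difference operator. -/
lemma modPairing_xSubOne_mul (P : ZMod (n + 1) → ZMod (n + 1))
    (f : AddMonoidAlgebra ℤ (ZMod (n + 1))) :
    modPairing P (xSubOne n * f) = modPairing (Δ_[1] P) f := by
  have h := Equiv.sum_comp (Equiv.addRight (1 : ZMod (n + 1)))
    fun i => (f.coeff (i - 1) : ZMod (n + 1)) * P i
  simp only [Equiv.coe_addRight, add_sub_cancel_right] at h
  simp only [modPairing, fwdDiff, mul_sub, Finset.sum_sub_distrib, h]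
  rw [← Finset.sum_sub_distrib]
  refine Finset.sum_congr rfl fun i _ => ?_
  rw [coeff_xSubOne_mul, Int.cast_sub, sub_mul]

lemma modPairing_xSubOne_pow_mul (l : ℕ) (P : ZMod (n + 1) → ZMod (n + 1))
    (f : AddMonoidAlgebra ℤ (ZMod (n + 1))) :
    modPairing P (xSubOne n ^ l * f) = modPairing (Δ_[1] ^[l] P) f := by
  induction l generalizing P with
  | zero => simp
  | succ l ih => rw [pow_succ', mul_assoc, modPairing_xSubOne_mul, ih, Function.iterate_succ_apply]

/-- Reed–Solomon codes are maximum distance separable: the coefficients of a multiple of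
`(x - 1) ^ l` satisfy all linear equations given by polynomials of degree less than `l`, so that at
least `l + 1` of them are nonzero modulo `n + 1`, unless all are zero. -/
lemma lt_card_coeff_ne_zero (hp : (n + 1).Prime) {l : ℕ} {f : AddMonoidAlgebra ℤ (ZMod (n + 1))}
    (hf : f ∈ craigIdeal n l) (h : ∃ i, (f.coeff i : ZMod (n + 1)) ≠ 0) :
    l < (Finset.univ.filter fun i => (f.coeff i : ZMod (n + 1)) ≠ 0).card := by
  classical
  have : Fact (n + 1).Prime := ⟨hp⟩
  obtain ⟨g, rfl⟩ := mem_craigIdeal.1 hf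
  set T := Finset.univ.filter fun i => ((xSubOne n ^ l * g).coeff i : ZMod (n + 1)) ≠ 0 with hT
  obtain ⟨t, ht⟩ := h
  have htT : t ∈ T := by simpa [hT] using ht
  by_contra! hcard
  -- the polynomial that vanishes exactly at the other elements of the support
  let P : Polynomial (ZMod (n + 1)) := ∏ i ∈ T.erase t, (Polynomial.X - Polynomial.C i)
  have hdeg : P.natDegree < l := by
    rw [Polynomial.natDegree_prod_of_monic _ _ fun i _ => Polynomial.monic_X_sub_C i]
    simp only [Polynomial.natDegree_X_sub_C, Finset.sum_const, smul_eq_mul, mul_one]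
    rw [Finset.card_erase_of_mem htT]
    have := Finset.card_pos.2 ⟨t, htT⟩
    omega
  have h1 := modPairing_xSubOne_pow_mul l (fun x => P.eval x) g
  rw [Polynomial.fwdDiff_iter_eq_zero_of_degree_lt hdeg] at h1
  simp only [modPairing, Pi.zero_apply, mul_zero, Finset.sum_const_zero] at h1
  rw [Finset.sum_eq_single t] at h1
  · refine mul_ne_zero ht ?_ h1
    rw [Polynomial.eval_prod, Finset.prod_ne_zero_iff]
    intro i hi
    rw [Polynomial.eval_sub, Polynomial.eval_X, Polynomial.eval_C, sub_ne_zero]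
    exact (Finset.ne_of_mem_erase hi).symm
  · intro i _ hi
    by_cases hiT : i ∈ T
    · rw [Polynomial.eval_prod, Finset.prod_eq_zero (Finset.mem_erase.2 ⟨hi, hiT⟩) (by simp),
        mul_zero]
    · rw [hT, Finset.mem_filter, not_and_not_right] at hiT
      rw [hiT (Finset.mem_univ i), zero_mul]
  · simp

/-- A nonzero vector of the Craig lattice `A_n^l` has squared norm at least `l`: either more than
`l` coefficients are nonzero, or all are divisible by `n + 1`. -/
lemma le_sum_coeff_sq (hp : (n + 1).Prime) {l : ℕ} (hl : l ≤ n)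
    {f : AddMonoidAlgebra ℤ (ZMod (n + 1))} (hf : f ∈ craigIdeal n l) (hf0 : f ≠ 0) :
    (l : ℤ) ≤ ∑ i, f.coeff i ^ 2 := by
  by_cases h : ∃ i, (f.coeff i : ZMod (n + 1)) ≠ 0
  · have h1 := lt_card_coeff_ne_zero hp hf h
    calc (l : ℤ) ≤ (Finset.univ.filter fun i => (f.coeff i : ZMod (n + 1)) ≠ 0).card := by
          exact_mod_cast h1.le
      _ = ∑ i ∈ Finset.univ.filter fun i => (f.coeff i : ZMod (n + 1)) ≠ 0, (1 : ℤ) := by simp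
      _ ≤ ∑ i ∈ Finset.univ.filter fun i => (f.coeff i : ZMod (n + 1)) ≠ 0, f.coeff i ^ 2 := by
          refine Finset.sum_le_sum fun i hi => ?_
          have hi' : f.coeff i ≠ 0 := fun h0 => (Finset.mem_filter.1 hi).2 (by simp [h0])
          exact Int.add_one_le_iff.2 (by positivity : (0 : ℤ) < f.coeff i ^ 2)
      _ ≤ _ := Finset.sum_le_sum_of_subset_of_nonneg (Finset.filter_subset _ _)
          fun _ _ _ => sq_nonneg _
  · push Not at h
    obtain ⟨i, hi⟩ : ∃ i, f.coeff i ≠ 0 := by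
      by_contra! h0
      exact hf0 (AddMonoidAlgebra.ext (Finsupp.ext h0))
    have h1 : ((n + 1 : ℕ) : ℤ) ∣ f.coeff i := (ZMod.intCast_zmod_eq_zero_iff_dvd _ _).1 (h i)
    have h2 := Int.le_of_dvd (abs_pos.2 hi) ((dvd_abs _ _).2 h1)
    have h3 : f.coeff i ^ 2 ≤ ∑ i, f.coeff i ^ 2 :=
      Finset.single_le_sum (f := fun i => f.coeff i ^ 2) (fun _ _ => sq_nonneg _)
        (Finset.mem_univ i)
    rw [← sq_abs] at h3
    push_cast at h2
    have h4 : (l : ℤ) ≤ n := by exact_mod_cast hl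
    nlinarith

end GroupRing

/-! ### Craig lattices -/

section Craig
open MeasureTheory Metric Module
open scoped RealInnerProductSpace

variable {n : ℕ}

/-- The vector of coefficients of an element of the group ring. -/
noncomputable def coeffVec :
    AddMonoidAlgebra ℤ (ZMod (n + 1)) →+ EuclideanSpace ℝ (ZMod (n + 1)) where
  toFun f := WithLp.toLp 2 fun i => (f.coeff i : ℝ)
  map_zero' := by ext; simp
  map_add' f g := by ext; simp

@[simp] lemma coeffVec_apply (f : AddMonoidAlgebra ℤ (ZMod (n + 1))) (i : ZMod (n + 1)) :
    coeffVec f i = f.coeff i := rfl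

lemma coeffVec_injective : Function.Injective (coeffVec (n := n)) := fun f g h =>
  AddMonoidAlgebra.ext (Finsupp.ext fun i => by
    have := congrArg (fun v => v i) h
    simpa using this)

lemma mem_craigLattice {l : ℕ} {v : EuclideanSpace ℝ (ZMod (n + 1))} :
    v ∈ craigLattice n l ↔ ∃ f ∈ craigIdeal n l, coeffVec f = v := by
  refine exists_congr fun f => and_congr_right fun _ => ⟨fun h => ?_, fun h => ?_⟩
  · ext i; simp [h i]
  · rintro i; simp [← h]

lemma toAddSubgroup_craigLattice (l : ℕ) :
    (craigLattice n l).toAddSubgroup = (craigIdeal n l).toAddSubgroup.map coeffVec := by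
  ext v
  exact mem_craigLattice

lemma norm_coeffVec_sq (f : AddMonoidAlgebra ℤ (ZMod (n + 1))) :
    ‖coeffVec f‖ ^ 2 = ((∑ i, f.coeff i ^ 2 : ℤ) : ℝ) := by
  rw [EuclideanSpace.norm_sq_eq]
  simp

lemma norm_coeffVec_single_mul (f : AddMonoidAlgebra ℤ (ZMod (n + 1))) (a : ZMod (n + 1)) :
    ‖coeffVec (AddMonoidAlgebra.single a 1 * f)‖ = ‖coeffVec f‖ := by
  rw [← sq_eq_sq₀ (norm_nonneg _) (norm_nonneg _), norm_coeffVec_sq, norm_coeffVec_sq]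
  simp only [coeff_single_one_mul']
  exact congrArg _ (Equiv.sum_comp (Equiv.subRight a) fun i => f.coeff i ^ 2)

instance discreteTopology_craigLattice (l : ℕ) : DiscreteTopology (craigLattice n l) := by
  refine discreteTopology_of_le (L := Submodule.span ℤ
    (Set.range (EuclideanSpace.basisFun (ZMod (n + 1)) ℝ).toBasis)) fun v hv => ?_
  obtain ⟨f, -, rfl⟩ := mem_craigLattice.1 hv
  rw [Basis.mem_span_iff_repr_mem]
  exact fun i => ⟨f.coeff i, by simp⟩

/-- The vector all of whose coordinates are `1`. -/
noncomputable def allOnes (n : ℕ) : EuclideanSpace ℝ (ZMod (n + 1)) := WithLp.toLp 2 fun _ => 1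

lemma allOnes_ne_zero : allOnes n ≠ 0 := fun h => by
  have := congrArg (fun v => v 0) h
  simp [allOnes] at this

lemma finrank_orthogonal_allOnes : finrank ℝ (ℝ ∙ allOnes n)ᗮ = n := by
  have : Fact (finrank ℝ (EuclideanSpace ℝ (ZMod (n + 1))) = n + 1) := ⟨by simp⟩
  exact Submodule.finrank_orthogonal_span_singleton allOnes_ne_zero

lemma coeffVec_mem_orthogonal_allOnes {f : AddMonoidAlgebra ℤ (ZMod (n + 1))} {l : ℕ}
    (hl : 1 ≤ l) (hf : f ∈ craigIdeal n l) : coeffVec f ∈ (ℝ ∙ allOnes n)ᗮ := by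
  obtain ⟨g, rfl⟩ := mem_craigIdeal.1 (craigIdeal_le hl hf)
  rw [Submodule.mem_orthogonal_singleton_iff_inner_right, PiLp.inner_apply]
  have h := Equiv.sum_comp (Equiv.subRight (1 : ZMod (n + 1))) fun i => (g.coeff i : ℝ)
  simp only [Equiv.subRight_apply] at h
  simp only [pow_one, allOnes, coeffVec_apply, coeff_xSubOne_mul, Int.cast_sub]
  simp [h]

open Polynomial in
/-- A sequence of period `n + 1`, a prime, which satisfies the recursion given by a nonzero integral
sequence of sum `0` is constant: since the cyclotomic polynomial is irreducible, the greatest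
common divisor of the characteristic polynomial and `X ^ (n + 1) - 1` is `X - 1`. -/
lemma eq_of_sum_coeff_mul_eq_zero (hp : (n + 1).Prime) {f : AddMonoidAlgebra ℤ (ZMod (n + 1))}
    (hf0 : f ≠ 0) (hf : ∑ i, f.coeff i = 0) {z : ZMod (n + 1) → ℝ}
    (hz : ∀ i, ∑ k, (f.coeff k : ℝ) * z (i + k) = 0) (i : ZMod (n + 1)) : z (i + 1) = z i := by
  have : Fact (n + 1).Prime := ⟨hp⟩
  let σ : (ZMod (n + 1) → ℝ) →ₗ[ℚ] (ZMod (n + 1) → ℝ) :=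
    LinearMap.funLeft ℚ ℝ fun i => i + 1
  have hσ (k : ℕ) (w : ZMod (n + 1) → ℝ) (i : ZMod (n + 1)) : (σ ^ k) w i = w (i + k) := by
    induction k generalizing i with
    | zero => simp
    | succ k ih =>
      rw [pow_succ', Module.End.mul_apply]
      change (σ ^ k) w (i + 1) = _
      rw [ih]; congr 1; push_cast; ring
  let F : ℚ[X] := ∑ k : ZMod (n + 1), C (f.coeff k : ℚ) * X ^ k.val
  have hFdeg : F.degree < (n + 1 : ℕ) := by
    rw [← mem_degreeLT]
    refine Submodule.sum_mem _ fun k _ => ?_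
    rw [mem_degreeLT]
    exact (degree_C_mul_X_pow_le _ _).trans_lt (by exact_mod_cast ZMod.val_lt k)
  have hF0 : F ≠ 0 := by
    intro h
    refine hf0 (AddMonoidAlgebra.ext (Finsupp.ext fun j => ?_))
    have h1 := congrArg (fun G : ℚ[X] => G.coeff j.val) h
    simp only [F, finsetSum_coeff, coeff_C_mul_X_pow, coeff_zero] at h1
    rw [Finset.sum_eq_single j] at h1
    · simpa using h1
    · intro b _ hb
      rw [if_neg fun h => hb (ZMod.val_injective _ h).symm]
    · simp
  have hF1 : X - 1 ∣ F := by
    rw [← C_1, dvd_iff_isRoot, IsRoot, eval_finsetSum]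
    simp only [eval_mul, eval_C, eval_pow, eval_X, one_pow, mul_one]
    exact_mod_cast hf
  have hcyc := cyclotomic_prime_mul_X_sub_one ℚ (n + 1)
  have hirr := cyclotomic.irreducible_rat (n := n + 1) n.succ_pos
  have hXq : (X ^ (n + 1) - 1 : ℚ[X]) ∣ F → False := fun h =>
    hF0 (eq_zero_of_dvd_of_degree_lt h (by
      rwa [← C_1, degree_X_pow_sub_C n.succ_pos]))
  have hX1 : IsCoprime (X - 1 : ℚ[X]) (cyclotomic (n + 1) ℚ) := by
    rw [← C_1, (irreducible_X_sub_C (1 : ℚ)).coprime_iff_not_dvd, dvd_iff_isRoot, IsRoot,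
      eval_one_cyclotomic_prime]
    exact_mod_cast hp.ne_zero
  have hcop : IsCoprime (cyclotomic (n + 1) ℚ) F := by
    refine (hirr.coprime_iff_not_dvd).2 fun h => hXq ?_
    rw [← hcyc, mul_comm]
    exact hX1.mul_dvd hF1 h
  obtain ⟨A, B, hAB⟩ := hcop
  have hXeq : (X - 1 : ℚ[X]) = A * (X ^ (n + 1) - 1) + (X - 1) * B * F := by
    rw [← hcyc]; linear_combination (-(X - 1 : ℚ[X])) * hAB
  have hFz : aeval σ F z = 0 := by
    funext i
    simp only [F, map_sum, map_mul, aeval_C, map_pow, aeval_X, LinearMap.sum_apply,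
      Finset.sum_apply, Module.End.mul_apply, Module.algebraMap_end_apply, Pi.smul_apply, hσ]
    rw [Pi.zero_apply, ← hz i]
    refine Finset.sum_congr rfl fun k _ => ?_
    rw [ZMod.natCast_zmod_val, Rat.smul_def]
    simp
  have hQz : aeval σ (X ^ (n + 1) - 1 : ℚ[X]) z = 0 := by
    funext i
    have : (i + ((n + 1 : ℕ) : ZMod (n + 1))) = i := by rw [ZMod.natCast_self, add_zero]
    simp only [map_sub, map_pow, aeval_X, map_one, LinearMap.sub_apply, Pi.sub_apply, hσ, this]
    simp
  have h1 : aeval σ (X - 1 : ℚ[X]) z = 0 := by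
    rw [hXeq, map_add, map_mul, map_mul, LinearMap.add_apply, Module.End.mul_apply,
      Module.End.mul_apply, hFz, hQz, map_zero, map_zero, add_zero]
  have h2 := congrFun h1 i
  simpa [sub_eq_zero, σ, LinearMap.funLeft_apply] using h2

/-- For `n + 1` prime the cyclic shifts of a nonzero vector of the lattice span the hyperplane
of vectors of coordinate sum `0`. -/
lemma span_shifts (hp : (n + 1).Prime) {l : ℕ} (hl : 1 ≤ l)
    {f : AddMonoidAlgebra ℤ (ZMod (n + 1))} (hf : f ∈ craigIdeal n l) (hf0 : f ≠ 0) :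
    Submodule.span ℝ (Set.range fun a => coeffVec (AddMonoidAlgebra.single a 1 * f)) =
      (ℝ ∙ allOnes n)ᗮ := by
  refine le_antisymm (Submodule.span_le.2 ?_) ?_
  · rintro _ ⟨a, rfl⟩
    exact coeffVec_mem_orthogonal_allOnes hl (Ideal.mul_mem_left _ _ hf)
  rw [← Submodule.orthogonal_orthogonal (Submodule.span ℝ (Set.range fun a =>
    coeffVec (AddMonoidAlgebra.single a 1 * f)))]
  refine Submodule.orthogonal_le fun z hz => ?_
  have hsum : ∑ i, f.coeff i = 0 := by
    have h := coeffVec_mem_orthogonal_allOnes hl hf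
    rw [Submodule.mem_orthogonal_singleton_iff_inner_right, PiLp.inner_apply] at h
    have h2 : ((∑ i, f.coeff i : ℤ) : ℝ) = 0 := by simpa [allOnes] using h
    exact_mod_cast h2
  have hconst := eq_of_sum_coeff_mul_eq_zero hp hf0 hsum (z := z) fun i => by
    have h := hz _ (Submodule.subset_span ⟨i, rfl⟩)
    rw [PiLp.inner_apply] at h
    simp only [coeffVec_apply, coeff_single_one_mul'] at h
    rw [← h, ← Equiv.sum_comp (Equiv.addLeft i) fun x => inner ℝ ((f.coeff (x - i) : ℤ) : ℝ) (z x)]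
    simp [mul_comm]
  have hz0 (k : ℕ) : z (k : ZMod (n + 1)) = z 0 := by
    induction k with
    | zero => simp
    | succ k ih => rw [Nat.cast_succ, hconst, ih]
  refine Submodule.mem_span_singleton.2 ⟨z 0, ?_⟩
  ext i
  have := hz0 i.val
  rw [ZMod.natCast_zmod_val] at this
  simp [allOnes, this]

lemma span_craigLattice (hp : (n + 1).Prime) {l : ℕ} (hl : 1 ≤ l) :
    Submodule.span ℝ (craigLattice n l : Set (EuclideanSpace ℝ (ZMod (n + 1)))) =
      (ℝ ∙ allOnes n)ᗮ := by
  have hn : n ≠ 0 := by rintro rfl; exact Nat.not_prime_one hp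
  refine le_antisymm (Submodule.span_le.2 fun v hv => ?_) ?_
  · obtain ⟨f, hf, rfl⟩ := mem_craigLattice.1 hv
    exact coeffVec_mem_orthogonal_allOnes hl hf
  · have hy : xSubOne n ^ l ∈ craigIdeal n l := mem_craigIdeal.2 dvd_rfl
    rw [← span_shifts hp hl hy (xSubOne_pow_ne_zero hn l)]
    refine Submodule.span_mono ?_
    rintro _ ⟨a, rfl⟩
    exact mem_craigLattice.2 ⟨_, Ideal.mul_mem_left _ _ hy, rfl⟩

lemma finrank_span_craigLattice (hp : (n + 1).Prime) {l : ℕ} (hl : 1 ≤ l) :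
    finrank ℝ (Submodule.span ℝ
      (craigLattice n l : Set (EuclideanSpace ℝ (ZMod (n + 1))))) = n := by
  rw [span_craigLattice hp hl, finrank_orthogonal_allOnes]

lemma finrank_craigLattice (hp : (n + 1).Prime) {l : ℕ} (hl : 1 ≤ l) :
    finrank ℤ (craigLattice n l) = n := by
  have h1 := Real.finrank_eq_int_finrank_of_discrete
    (s := (craigLattice n l : Set (EuclideanSpace ℝ (ZMod (n + 1)))))
    (by rw [Submodule.span_eq]; infer_instance)
  rw [Set.finrank, Set.finrank, Submodule.span_eq, finrank_span_craigLattice hp hl] at h1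
  exact h1.symm

/-- A nonzero vector of the Craig lattice yields `n` independent ones of the same length. -/
lemma exists_linearIndependent_norm_eq (hp : (n + 1).Prime) {l : ℕ} (hl : 1 ≤ l)
    {f : AddMonoidAlgebra ℤ (ZMod (n + 1))} (hf : f ∈ craigIdeal n l) (hf0 : f ≠ 0) :
    ∃ v : Fin n → EuclideanSpace ℝ (ZMod (n + 1)), LinearIndependent ℝ v ∧
      (∀ i, v i ∈ craigLattice n l) ∧ ∀ i, ‖v i‖ = ‖coeffVec f‖ := by
  obtain ⟨v, hv, -, hind⟩ := Submodule.exists_fun_fin_finrank_span_eq ℝ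
    (Set.range fun a => coeffVec (AddMonoidAlgebra.single a 1 * f))
  have hfr : n = finrank ℝ (Submodule.span ℝ
      (Set.range fun a => coeffVec (AddMonoidAlgebra.single a 1 * f))) := by
    rw [span_shifts hp hl hf hf0, finrank_orthogonal_allOnes]
  refine ⟨v ∘ finCongr hfr, hind.comp _ (finCongr hfr).injective, fun i => ?_, fun i => ?_⟩
  · obtain ⟨a, ha⟩ := hv (finCongr hfr i)
    exact mem_craigLattice.2 ⟨_, Ideal.mul_mem_left _ _ hf, ha⟩
  · obtain ⟨a, ha⟩ := hv (finCongr hfr i)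
    rw [Function.comp_apply, ← ha]
    exact norm_coeffVec_single_mul f a

lemma sqrt_le_norm_of_mem_craigLattice (hp : (n + 1).Prime) {l : ℕ} (hl : l ≤ n)
    {v : EuclideanSpace ℝ (ZMod (n + 1))} (hv : v ∈ craigLattice n l) (hv0 : v ≠ 0) :
    √l ≤ ‖v‖ := by
  obtain ⟨f, hf, rfl⟩ := mem_craigLattice.1 hv
  have hf0 : f ≠ 0 := by rintro rfl; exact hv0 (map_zero _)
  refine Real.sqrt_le_iff.2 ⟨norm_nonneg _, ?_⟩
  rw [norm_coeffVec_sq]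
  exact_mod_cast le_sum_coeff_sq hp hl hf hf0

lemma norm_coeffVec_xSubOne (hn : n ≠ 0) : ‖coeffVec (xSubOne n)‖ = √2 := by
  have : Fact (1 < n + 1) := ⟨by omega⟩
  rw [← Real.sqrt_sq (norm_nonneg _), norm_coeffVec_sq]
  congr 1
  have h1 : ∀ i : ZMod (n + 1), ((xSubOne n).coeff i) ^ 2 =
      (if i = 1 then 1 else 0) + if i = 0 then 1 else 0 := by
    intro i
    simp only [xSubOne, AddMonoidAlgebra.coeff_sub, AddMonoidAlgebra.one_def,
      AddMonoidAlgebra.coeff_single, Finsupp.sub_apply, Finsupp.single_apply, eq_comm (b := i)]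
    by_cases h : i = 1
    · simp [h]
    · by_cases h' : i = 0 <;> simp [h, h']
  simp only [h1, Finset.sum_add_distrib]
  simp

/-- The volume of `A_n^l` is at most `(n + 1) ^ (l - 1)` times that of the root lattice `A_n`, which
is bounded by Hadamard's inequality. -/
lemma covolume_craigLattice_le (hp : (n + 1).Prime) (l : ℕ) :
    ZLattice.covolume (latticeInSpan (craigLattice n (l + 1))) ≤ (n + 1) ^ l * √2 ^ n := by
  have hn : n ≠ 0 := by rintro rfl; exact Nat.not_prime_one hp
  have hle : craigLattice n (l + 1) ≤ craigLattice n 1 := fun v hv => by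
    obtain ⟨f, hf, rfl⟩ := mem_craigLattice.1 hv
    exact mem_craigLattice.2 ⟨f, craigIdeal_le (by omega) hf, rfl⟩
  rw [covolume_latticeInSpan_eq _ _ hle (by
    rw [span_craigLattice hp le_rfl, span_craigLattice hp (by omega)]),
    toAddSubgroup_craigLattice, toAddSubgroup_craigLattice,
    AddSubgroup.relIndex_map_map_of_injective _ _ coeffVec_injective]
  refine mul_le_mul ?_ ?_ (ZLattice.covolume_pos (latticeInSpan (craigLattice n 1))).le
    (by positivity)
  · exact_mod_cast relIndex_craigIdeal_le (n := n) l
  · obtain ⟨v, hv, hvL, hvn⟩ := exists_linearIndependent_norm_eq hp le_rfl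
      (mem_craigIdeal.2 (pow_one (xSubOne n)).dvd) (xSubOne_ne_zero hn)
    refine covolume_le_pow (L := latticeInSpan (craigLattice n 1))
      (finrank_span_craigLattice hp le_rfl)
      (v := fun i => ⟨v i, Submodule.subset_span (hvL i)⟩)
      (LinearIndependent.of_comp (Submodule.span ℝ
        (craigLattice n 1 : Set (EuclideanSpace ℝ (ZMod (n + 1))))).subtype hv) hvL fun i => ?_
    exact ((hvn i).trans (norm_coeffVec_xSubOne hn)).le

lemma covolume_craigLattice_le_pow (hp : (n + 1).Prime) {l : ℕ} (hl : 1 ≤ l)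
    (hexp : ((n : ℝ) + 1) ^ (l - 1) ≤ Real.exp (n / 2)) :
    ZLattice.covolume (latticeInSpan (craigLattice n l)) ≤ 3 ^ n := by
  obtain ⟨m, rfl⟩ := Nat.exists_eq_add_of_le' hl
  have h1 : Real.exp (n / 2) * √2 ^ n = √(Real.exp 1 * 2) ^ n := by
    rw [Real.sqrt_mul (Real.exp_nonneg 1), mul_pow, ← Real.exp_half, ← Real.exp_nat_mul]
    congr 2; ring
  refine (covolume_craigLattice_le hp m).trans
    ((mul_le_mul_of_nonneg_right hexp (by positivity)).trans ?_)
  rw [h1]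
  refine pow_le_pow_left₀ (Real.sqrt_nonneg _) (Real.sqrt_le_iff.2 ⟨by norm_num, ?_⟩) n
  linarith [Real.exp_one_lt_d9]

/-- Minkowski's theorem gives one short vector, and its cyclic shifts give `n` of them. -/
lemma exists_linearIndependent_norm_le (hp : (n + 1).Prime) {l : ℕ} (hl : 1 ≤ l)
    (hexp : ((n : ℝ) + 1) ^ (l - 1) ≤ Real.exp (n / 2)) :
    ∃ v : Fin n → EuclideanSpace ℝ (ZMod (n + 1)), LinearIndependent ℝ v ∧
      (∀ i, v i ∈ craigLattice n l) ∧ ∀ i, ‖v i‖ ≤ 4 * √n := by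
  have hn : 0 < n := Nat.pos_of_ne_zero (by rintro rfl; exact Nat.not_prime_one hp)
  have hn' : 0 < √(n : ℝ) := Real.sqrt_pos.2 (by exact_mod_cast hn)
  have hd := finrank_span_craigLattice hp hl
  obtain ⟨x, hx, hx0, hxn⟩ := exists_ne_zero_norm_lt (L := latticeInSpan (craigLattice n l)) hd
    (r := 4 * √n) (by positivity) (by
      calc _ ≤ (3 : ℝ) ^ n * 2 ^ n := mul_le_mul_of_nonneg_right
            (covolume_craigLattice_le_pow hp hl hexp) (by positivity)
        _ = 6 ^ n := by rw [← mul_pow]; norm_num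
        _ < 8 ^ n := pow_lt_pow_left₀ (by norm_num) (by norm_num) hn.ne'
        _ = (4 * √n) ^ n * (2 / √n) ^ n := by
            rw [← mul_pow]; congr 1; field_simp; norm_num
        _ ≤ _ := mul_le_mul_of_nonneg_left (pow_le_volume_unitBall hd hn) (by positivity))
  obtain ⟨f, hf, hfx⟩ := mem_craigLattice.1 hx
  have hf0 : f ≠ 0 := by
    rintro rfl
    exact hx0 (Subtype.ext (by rw [map_zero] at hfx; exact hfx.symm))
  obtain ⟨v, hv, hvL, hvn⟩ := exists_linearIndependent_norm_eq hp hl hf hf0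
  refine ⟨v, hv, hvL, fun i => ?_⟩
  rw [hvn i, hfx]
  exact hxn.le

/-- Half of the first minimum is a packing radius. -/
lemma pow_mul_volume_le_covolume (hp : (n + 1).Prime) {l : ℕ} (hl : 1 ≤ l) (hln : l ≤ n) :
    √l ^ n * volume.real (ball (0 : Submodule.span ℝ
      (craigLattice n l : Set (EuclideanSpace ℝ (ZMod (n + 1))))) 1) ≤
      ZLattice.covolume (latticeInSpan (craigLattice n l)) * 2 ^ n := by
  by_contra! h
  obtain ⟨x, hx, hx0, hxn⟩ := exists_ne_zero_norm_lt (L := latticeInSpan (craigLattice n l))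
    (finrank_span_craigLattice hp hl) (Real.sqrt_pos.2 (by exact_mod_cast hl)) h
  exact absurd (sqrt_le_norm_of_mem_craigLattice hp hln hx fun h => hx0 (Subtype.ext h))
    (not_le.2 hxn)

end Craig

/-! ### Asymptotics of the parameters -/

section Density
open MeasureTheory Metric Module

/-- The code lattices over a single Craig lattice, under explicit numerical conditions. The radius
`r` is chosen so that the expected number of pairs of points of norm less than `r` is just below
`1`; the first inequality says that `r` is at most `p` times the first minimum, the second one that
the ball of radius `r` is large enough for its points to be counted by its volume. -/
lemma exists_code_craigLattice {n : ℕ} (hn : (n + 1).Prime) {l : ℕ} (hl : 1 ≤ l) (hln : l ≤ n)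
    (hexp : ((n : ℝ) + 1) ^ (l - 1) ≤ Real.exp (n / 2)) {p : ℕ} (hp : p.Prime) {k : ℕ} (hk : k ≤ n)
    {s η : ℝ} (hη1 : η ≤ 1 / 2) (hs : 0 < s) (hs1 : s < 1)
    (hη : Real.exp (2 * s) * (1 - η) < 1 - s ^ 2) (hη0 : 0 ≤ η)
    (hA : (3 * √n) ^ n ≤ (p : ℝ) ^ k * √l ^ n)
    (hB : (8 * n * √n / s ^ 2) ^ n ≤ (p : ℝ) ^ (n - k) * √l ^ n)
    (b : Basis (Fin n) ℤ (craigLattice n l)) :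
    ∃ C : Submodule (ZMod p) (Fin n → ZMod p), finrank (ZMod p) C = k ∧
      (1 - η) / 2 ^ (n - 1) ≤ packingDensity (codeLattice (naturalReduction b p) C) := by
  have hn0 : 0 < n := Nat.pos_of_ne_zero (by rintro rfl; exact Nat.not_prime_one hn)
  have hnR : (0 : ℝ) < n := by exact_mod_cast hn0
  have hp0 : (0 : ℝ) < p := by exact_mod_cast hp.pos
  have hd := finrank_span_craigLattice hn hl
  obtain ⟨v, hv, hvL, hvn⟩ := exists_linearIndependent_norm_le hn hl hexp
  set V := ZLattice.covolume (latticeInSpan (craigLattice n l)) with hV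
  set ω := volume.real (ball (0 : Submodule.span ℝ
    (craigLattice n l : Set (EuclideanSpace ℝ (ZMod (n + 1))))) 1) with hω
  have hV0 : 0 < V := ZLattice.covolume_pos (latticeInSpan (craigLattice n l))
  have hω1 : (2 / √n) ^ n ≤ ω := pow_le_volume_unitBall hd hn0
  have hω0 : 0 < ω := lt_of_lt_of_le (by positivity) hω1
  have hV1 : V ≤ 3 ^ n := covolume_craigLattice_le_pow hn hl hexp
  have hV2 : √l ^ n * ω ≤ V * 2 ^ n := pow_mul_volume_le_covolume hn hl hln
  set R := 2 * (1 - η) * (p : ℝ) ^ (n - k) * V / ω with hR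
  have hη' : 0 < 1 - η := by linarith
  have hR0 : 0 < R := div_pos (mul_pos (mul_pos (by linarith) (pow_pos hp0 _)) hV0) hω0
  have hrn : (R ^ ((n : ℝ)⁻¹)) ^ n = R := Real.rpow_inv_natCast_pow hR0.le hn0.ne'
  set r := R ^ ((n : ℝ)⁻¹) with hr
  have hr0 : 0 < r := Real.rpow_pos_of_pos hR0 _
  have hpk : (p : ℝ) ^ n = p ^ (n - k) * p ^ k := by rw [← pow_add, Nat.sub_add_cancel hk]
  have hpnk : (0 : ℝ) < (p : ℝ) ^ (n - k) := pow_pos hp0 _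
  refine exists_code_packingDensity_ge (craigLattice n l) hn0 hd b hp hk hv hvL hvn
    (fun x hx hx0 => sqrt_le_norm_of_mem_craigLattice hn hln hx hx0) hr0 ?_ ?_ hs hs1 ?_ hη
  · rw [hrn, hR, div_mul_cancel₀ _ hω0.ne']
  · refine le_of_pow_le_pow_left₀ hn0.ne' (by positivity) ?_
    rw [hrn, hR, div_le_iff₀ hω0]
    have h2 : (2 : ℝ) ≤ 2 ^ n := le_self_pow₀ one_le_two hn0.ne'
    calc 2 * (1 - η) * (p : ℝ) ^ (n - k) * V ≤ 2 ^ n * (p : ℝ) ^ (n - k) * 3 ^ n := by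
          refine mul_le_mul (mul_le_mul_of_nonneg_right ?_ hpnk.le) hV1 hV0.le (by positivity)
          linarith
      _ = (p : ℝ) ^ (n - k) * ((3 * √n) ^ n * (2 / √n) ^ n) := by
          rw [← mul_pow (3 * √n), mul_comm (2 ^ n : ℝ), mul_assoc, ← mul_pow]
          congr 2
          field_simp
      _ ≤ (p : ℝ) ^ (n - k) * (((p : ℝ) ^ k * √l ^ n) * ω) := by
          refine mul_le_mul_of_nonneg_left ?_ hpnk.le
          exact mul_le_mul hA hω1 (by positivity) (by positivity)
      _ = (p * √l) ^ n * ω := by rw [mul_pow, hpk]; ring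
  · have h1 : 8 * n * √n / s ^ 2 ≤ 2 * r := by
      refine le_of_pow_le_pow_left₀ hn0.ne' (by positivity) (hB.trans ?_)
      rw [mul_pow, hrn, hR, mul_div_assoc', le_div_iff₀ hω0]
      calc (p : ℝ) ^ (n - k) * √l ^ n * ω ≤ (p : ℝ) ^ (n - k) * (V * 2 ^ n) := by
            rw [mul_assoc]; exact mul_le_mul_of_nonneg_left hV2 hpnk.le
        _ ≤ 2 * (1 - η) * ((p : ℝ) ^ (n - k) * (V * 2 ^ n)) :=
            le_mul_of_one_le_left (by positivity) (by linarith)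
        _ = _ := by ring
    rw [div_le_iff₀ (by positivity)] at h1
    linarith

end Density

section Asymptotics
open Topology

lemma tendsto_log_natCast : Tendsto (fun n : ℕ => Real.log n) atTop atTop :=
  Real.tendsto_log_atTop.comp tendsto_natCast_atTop_atTop

lemma eventually_craigExponent : ∀ᶠ n : ℕ in atTop, 1 ≤ craigExponent n ∧ craigExponent n ≤ n ∧
    ((n : ℝ) + 1) ^ (craigExponent n - 1) ≤ Real.exp (n / 2) ∧
    (n : ℝ) / (4 * Real.log n) ≤ craigExponent n := by
  have hlog : ∀ᶠ n : ℕ in atTop, Real.log n ≤ (1 / 6) * (n : ℝ) := by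
    have := (Real.isLittleO_log_id_atTop.comp_tendsto tendsto_natCast_atTop_atTop).bound
      (show (0 : ℝ) < 1 / 6 by norm_num)
    filter_upwards [this] with n hn
    simp only [Function.comp_apply, id, Real.norm_eq_abs, Nat.abs_cast] at hn
    exact (le_abs_self _).trans hn
  filter_upwards [hlog, tendsto_log_natCast.eventually_ge_atTop 1, eventually_ge_atTop 3]
    with n h6 h1 h3
  have h3' : (3 : ℝ) ≤ n := by exact_mod_cast h3
  set M := Real.log ((n : ℝ) + 1) with hM
  have hM1 : Real.log n ≤ M := Real.log_le_log (by linarith) (by linarith)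
  have hM2 : 2 * M ≤ 3 * Real.log n := by
    have := Real.log_le_log (by positivity)
      (show ((n : ℝ) + 1) ^ 2 ≤ (n : ℝ) ^ 3 by nlinarith [sq_nonneg ((n : ℝ) - 3)])
    rw [Real.log_pow, Real.log_pow] at this
    push_cast at this
    exact this
  have hM0 : 0 < M := by linarith
  set u := (n : ℝ) / (2 * M) with hu
  have huM : u * (2 * M) = n := div_mul_cancel₀ _ (by positivity)
  have hround := abs_le.1 (abs_sub_round u)
  have hu1 : (n : ℝ) / (4 * Real.log n) + 1 / 2 ≤ u := by
    have h4 : (n : ℝ) / (3 * Real.log n) ≤ u :=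
      div_le_div_of_nonneg_left (by linarith) (by positivity) hM2
    refine le_trans ?_ h4
    rw [div_add_div _ _ (by positivity) (by positivity), div_le_div_iff₀ (by positivity)
      (by positivity)]
    nlinarith
  have hpos : 0 < (n : ℝ) / (4 * Real.log n) := by positivity
  have hr0 : 0 < round u := by
    have : (0 : ℝ) < round u := by linarith [hround.2]
    exact_mod_cast this
  have hcast : (craigExponent n : ℝ) = round u := by
    have : ((craigExponent n : ℕ) : ℤ) = round u := Int.toNat_of_nonneg hr0.le
    exact_mod_cast this
  have h1l : 1 ≤ craigExponent n := by
    have : (0 : ℝ) < craigExponent n := by rw [hcast]; exact_mod_cast hr0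
    exact_mod_cast this
  refine ⟨h1l, ?_, ?_, ?_⟩
  · have : (craigExponent n : ℝ) ≤ n := by rw [hcast]; nlinarith [hround.1]
    exact_mod_cast this
  · rw [← Real.exp_log (show (0 : ℝ) < (n : ℝ) + 1 by linarith), ← Real.exp_nat_mul,
      Real.exp_le_exp, ← hM, Nat.cast_sub h1l, hcast, Nat.cast_one]
    nlinarith [hround.1]
  · rw [hcast]; linarith [hround.2]

/-- The logarithmic forms of the two inequalities of `exists_code_craigLattice`. -/
lemma pow_le_of_log_le {n k p l : ℕ} (hn : 3 ≤ n) (hk : k ≤ n) (hp : 0 < p)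
    (hl : (n : ℝ) / (4 * Real.log n) ≤ l) {s : ℝ} (hs : 0 < s)
    (hA : Real.log 6 + Real.log (Real.log n) / 2 ≤ (k : ℝ) / n * Real.log p)
    (hB : Real.log (16 / s ^ 2) + Real.log n + Real.log (Real.log n) / 2 ≤
      (1 - (k : ℝ) / n) * Real.log p) :
    (3 * √n) ^ n ≤ (p : ℝ) ^ k * √l ^ n ∧
      (8 * n * √n / s ^ 2) ^ n ≤ (p : ℝ) ^ (n - k) * √l ^ n := by
  have hn' : (3 : ℝ) ≤ n := by exact_mod_cast hn
  have hnpos : (0 : ℝ) < n := by linarith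
  have hlogn : 0 < Real.log n := Real.log_pos (by linarith)
  have hl0 : (0 : ℝ) < l := lt_of_lt_of_le (by positivity) hl
  have hp' : (0 : ℝ) < p := by exact_mod_cast hp
  have hll : Real.log n - Real.log 4 - Real.log (Real.log n) ≤ Real.log l := by
    have := Real.log_le_log (by positivity) hl
    rw [Real.log_div hnpos.ne' (by positivity), Real.log_mul (by norm_num) hlogn.ne'] at this
    linarith
  have h4 : Real.log 4 = 2 * Real.log 2 := by
    rw [show (4 : ℝ) = 2 ^ 2 by norm_num, Real.log_pow]; norm_num
  have h6 : Real.log 6 = Real.log 3 + Real.log 2 := by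
    rw [← Real.log_mul (by norm_num) (by norm_num)]; norm_num
  have h16 : Real.log (16 / s ^ 2) = Real.log (8 / s ^ 2) + Real.log 2 := by
    rw [← Real.log_mul (by positivity) (by norm_num)]; congr 1; ring
  constructor
  · rw [← Real.log_le_log_iff (by positivity) (by positivity), Real.log_pow,
      Real.log_mul (by positivity) (by positivity), Real.log_mul (by positivity) (by positivity),
      Real.log_pow, Real.log_pow, Real.log_sqrt hnpos.le, Real.log_sqrt hl0.le]
    rw [show (k : ℝ) * Real.log p = n * ((k : ℝ) / n * Real.log p) by field_simp, ← mul_add]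
    refine mul_le_mul_of_nonneg_left ?_ hnpos.le
    linarith
  · rw [← Real.log_le_log_iff (by positivity) (by positivity), Real.log_pow,
      Real.log_mul (by positivity) (by positivity), Real.log_pow, Real.log_pow,
      show 8 * (n : ℝ) * √n / s ^ 2 = 8 / s ^ 2 * n * √n by ring,
      Real.log_mul (by positivity) (by positivity), Real.log_mul (by positivity) (by positivity),
      Real.log_sqrt hnpos.le, Real.log_sqrt hl0.le, Nat.cast_sub hk,
      show (n : ℝ) - k = n * (1 - (k : ℝ) / n) by field_simp, mul_assoc (n : ℝ), ← mul_add]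
    refine mul_le_mul_of_nonneg_left ?_ hnpos.le
    linarith

lemma tendsto_rate : Tendsto (fun n : ℕ => Real.log (Real.log n) /
    (2 * Real.log n + Real.log (Real.log n))) atTop (𝓝 0) := by
  have h := (Real.isLittleO_log_id_atTop.tendsto_div_nhds_zero).comp tendsto_log_natCast
  refine squeeze_zero' ?_ ?_ h
  · filter_upwards [tendsto_log_natCast.eventually_ge_atTop 1] with n hn
    have := Real.log_nonneg hn
    positivity
  · filter_upwards [tendsto_log_natCast.eventually_ge_atTop 1] with n hn
    have := Real.log_nonneg hn
    change _ ≤ Real.log (Real.log n) / Real.log n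
    exact div_le_div_of_nonneg_left this (by linarith) (by linarith)

lemma exists_prime_seq {ν : ℝ} (hν : 0 < ν) : ∃ p : ℕ → ℕ, (∀ n, (p n).Prime) ∧
    (fun n : ℕ => (p n : ℝ)) =O[atTop]
      (fun n : ℕ => ((n : ℝ) * Real.sqrt (Real.log n)) ^ (1 + ν)) ∧
    ∀ᶠ n : ℕ in atTop,
      (1 + ν) * (Real.log n + Real.log (Real.log n) / 2) ≤ Real.log (p n) := by
  set X : ℕ → ℝ := fun n => ((n : ℝ) * Real.sqrt (Real.log n)) ^ (1 + ν) with hX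
  choose p hp hlt hle using fun n : ℕ =>
    Nat.exists_prime_lt_and_le_two_mul (⌈X n⌉₊ + 1) (Nat.succ_ne_zero _)
  have hX0 (n : ℕ) : 0 ≤ X n := by positivity
  refine ⟨p, hp, ?_, ?_⟩
  · refine IsBigO.of_bound 6 ?_
    filter_upwards [tendsto_log_natCast.eventually_ge_atTop 1, eventually_ge_atTop 1] with n h1 h2
    have h2' : (1 : ℝ) ≤ n := by exact_mod_cast h2
    have hX1 : 1 ≤ X n :=
      Real.one_le_rpow (one_le_mul_of_one_le_of_one_le h2' (Real.one_le_sqrt.2 h1)) (by linarith)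
    rw [Real.norm_of_nonneg (Nat.cast_nonneg _), Real.norm_of_nonneg (hX0 n)]
    have h3 : (p n : ℝ) ≤ 2 * (⌈X n⌉₊ + 1) := by exact_mod_cast hle n
    have h4 := Nat.ceil_lt_add_one (hX0 n)
    linarith
  · filter_upwards [tendsto_log_natCast.eventually_ge_atTop 1, eventually_ge_atTop 1] with n h1 h2
    have h2' : (0 : ℝ) < n := by exact_mod_cast h2
    have h1' : 0 < Real.log n := by linarith
    have hpos : 0 < (n : ℝ) * √(Real.log n) := by positivity
    have h3 : X n ≤ p n := by
      have : (⌈X n⌉₊ : ℝ) + 1 < p n := by exact_mod_cast hlt n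
      linarith [Nat.le_ceil (X n)]
    have h4 := Real.log_le_log (Real.rpow_pos_of_pos hpos (1 + ν)) h3
    rwa [Real.log_rpow hpos, Real.log_mul h2'.ne' (Real.sqrt_pos.2 h1').ne',
      Real.log_sqrt h1'.le] at h4

lemma exists_small_parameter {η : ℝ} (hη : 0 < η) :
    ∃ s : ℝ, 0 < s ∧ s < 1 ∧ Real.exp (2 * s) * (1 - η) < 1 - s ^ 2 := by
  have hc : ContinuousAt (fun s : ℝ => 1 - s ^ 2 - Real.exp (2 * s) * (1 - η)) 0 := by fun_prop
  have h1 : ∀ᶠ s : ℝ in 𝓝 0, 0 < 1 - s ^ 2 - Real.exp (2 * s) * (1 - η) :=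
    hc.eventually_const_lt (by simpa using hη)
  have h2 : ∀ᶠ s : ℝ in 𝓝[>] 0, 0 < s ∧ s < 1 := by
    filter_upwards [Ioo_mem_nhdsGT (zero_lt_one (α := ℝ))] with s hs using hs
  obtain ⟨s, hs, hs'⟩ := ((h1.filter_mono nhdsWithin_le_nhds).and h2).exists
  exact ⟨s, hs'.1, hs'.2, by linarith⟩

end Asymptotics

theorem mainTheorem5 (ν : ℝ) (hν : 0 < ν) :
    ∃ p : ℕ → ℕ, (∀ n, (p n).Prime) ∧
      (fun n : ℕ => (p n : ℝ)) =O[atTop]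
        (fun n : ℕ => ((n : ℝ) * Real.sqrt (Real.log n)) ^ (1 + ν)) ∧
      ∀ k : ℕ → ℕ,
        (fun n : ℕ => (k n : ℝ) / n) ~[atTop]
          (fun n : ℕ => Real.log (Real.log n) / (2 * Real.log n + Real.log (Real.log n))) →
        ∀ ε : ℝ, 0 < ε → ∀ᶠ n : ℕ in atTop, (n + 1).Prime →
          Module.finrank ℤ (craigLattice n (craigExponent n)) = n ∧
          ∀ b : Module.Basis (Fin n) ℤ (craigLattice n (craigExponent n)),
            ∃ C : Submodule (ZMod (p n)) (Fin n → ZMod (p n)),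
              Module.finrank (ZMod (p n)) C = k n ∧
              (1 - ε) / 2 ^ (n - 1) <
                packingDensity (codeLattice (naturalReduction b (p n)) C) := by
  obtain ⟨p, hp, hpO, hplog⟩ := exists_prime_seq hν
  refine ⟨p, hp, hpO, fun k hk ε hε => ?_⟩
  set η := min ε 1 / 2 with hη
  have hη0 : 0 < η := by positivity
  have hη1 : η ≤ 1 / 2 := by have := min_le_right ε 1; linarith
  have hηε : η < ε := by have := min_le_left ε 1; linarith
  obtain ⟨s, hs, hs1, hsη⟩ := exists_small_parameter hη0
  obtain ⟨φ, hφ, hkφ⟩ := hk.exists_eq_mul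
  have hδ : Tendsto (fun n : ℕ => (k n : ℝ) / n) atTop (nhds 0) := hk.symm.tendsto_nhds tendsto_rate
  have hloglog : Tendsto (fun n : ℕ => Real.log (Real.log n)) atTop atTop :=
    Real.tendsto_log_atTop.comp tendsto_log_natCast
  have hc1 : ∀ᶠ n : ℕ in atTop, 1 + ν / 2 < (1 - (k n : ℝ) / n) * (1 + ν) := by
    have : Tendsto (fun n : ℕ => (1 - (k n : ℝ) / n) * (1 + ν)) atTop (nhds ((1 - 0) * (1 + ν))) :=
      (tendsto_const_nhds.sub hδ).mul_const _
    exact this.eventually_const_lt (by linarith)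
  have hc2 : ∀ᶠ n : ℕ in atTop, 1 + ν / 2 < φ n * (1 + ν) :=
    (hφ.mul_const (1 + ν)).eventually_const_lt (by linarith)
  filter_upwards [eventually_craigExponent, hplog, hkφ, hc1, hc2, hδ.eventually_lt_const one_pos,
    tendsto_log_natCast.eventually_ge_atTop 1,
    tendsto_log_natCast.eventually_ge_atTop (2 * Real.log (16 / s ^ 2) / ν),
    hloglog.eventually_ge_atTop (4 * Real.log 6 / ν), eventually_ge_atTop 3]
    with n hl hpn hkn h1 h2 hk1 hlog1 hlog2 hlog3 hn3 hn
  obtain ⟨hl1, hln, hexp, hl4⟩ := hl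
  refine ⟨finrank_craigLattice hn hl1, fun b => ?_⟩
  have hn0 : (0 : ℝ) < n := by positivity
  have hkn' : k n ≤ n := by
    rw [div_lt_one hn0] at hk1
    exact_mod_cast hk1.le
  rw [div_le_iff₀ hν] at hlog2 hlog3
  have hb0 : 0 ≤ Real.log (Real.log n) := Real.log_nonneg hlog1
  have hA : Real.log 6 + Real.log (Real.log n) / 2 ≤ (k n : ℝ) / n * Real.log (p n) := by
    have h3 := mul_le_mul_of_nonneg_left hpn (show 0 ≤ (k n : ℝ) / n by positivity)
    have h4 : (k n : ℝ) / n * ((1 + ν) * (Real.log n + Real.log (Real.log n) / 2)) =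
        φ n * (1 + ν) * (Real.log (Real.log n) / 2) := by
      rw [show (k n : ℝ) / n = _ from hkn]
      have : 2 * Real.log n + Real.log (Real.log n) ≠ 0 := by positivity
      simp only [Pi.mul_apply]
      field_simp
    rw [h4] at h3
    nlinarith
  have hB : Real.log (16 / s ^ 2) + Real.log n + Real.log (Real.log n) / 2 ≤
      (1 - (k n : ℝ) / n) * Real.log (p n) := by
    have h3 := mul_le_mul_of_nonneg_left hpn (show 0 ≤ 1 - (k n : ℝ) / n by linarith)
    nlinarith
  obtain ⟨hA', hB'⟩ := pow_le_of_log_le hn3 hkn' (hp n).pos hl4 hs hA hB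
  obtain ⟨C, hC, hdens⟩ := exists_code_craigLattice hn hl1 hln hexp (hp n) hkn' hη1 hs hs1 hsη
    hη0.le hA' hB' b
  refine ⟨C, hC, lt_of_lt_of_le ?_ hdens⟩
  exact div_lt_div_of_pos_right (by linarith) (by positivity)
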